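/- Let $X$ be a random vector in $\mathbb{R}^d$ with mean zero and identity covariance matrix, let $X_1, X_2, \dots$ be independent copies of $X$, and put $Z_n = (X_1+\dots+X_n)/\sqrt{n}$. Let $\varphi(x) = (2\pi)^{-d/2} e^{-|x|^2/2}$ be the standard normal density on $\mathbb{R}^d$, and for a probability density $p$ on $\mathbb{R}^d$ put $$T_\infty(p\|\varphi) = \operatorname*{ess\,sup}_{x\in\mathbb{R}^d} \frac{p(x)-\varphi(x)}{\varphi(x)} \in [0,\infty].$$ Assume that for some $n_0 \ge 1$ the vector $Z_{n_0}$ has a density $p_{n_0}$ with $T_\infty(p_{n_0}\|\varphi) < \infty$, and that $X$ has the separation property: for every $t_0 > 0$, $$\sup_{|t|\ge t_0} e^{-|t|^2/2}\, \mathbb{E}\, e^{\langle t, X\rangle} < 1 .$$ Then $Z_n$ has a density $p_n$ for all sufficiently large $n$, and $T_\infty(p_n\|\varphi) \to 0$ as $n \to \infty$. -/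

import Mathlib

open MeasureTheory ProbabilityTheory Filter Topology
open scoped ENNReal

/-- The density `φ(x) = (2π)^{-d/2} exp(-|x|²/2)` of the standard normal law on `ℝᵈ`. -/
noncomputable def stdNormalDensity (d : ℕ) (x : EuclideanSpace ℝ (Fin d)) : ℝ :=
  1 / (2 * Real.pi) ^ ((d : ℝ) / 2) * Real.exp (-‖x‖ ^ 2 / 2)

/-- The quantity `T_∞(p‖q) = ess sup_x (p(x) - q(x)) / q(x)`, where the essential supremum is taken
with respect to Lebesgue measure on `ℝᵈ`. It is computed in the extended reals, so that it is `⊤`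
exactly when the ratio is not essentially bounded from above. -/
noncomputable def tsallisInf {d : ℕ} (p q : EuclideanSpace ℝ (Fin d) → ℝ) : EReal :=
  essSup (fun x => (((p x - q x) / q x : ℝ) : EReal)) volume

/-- The moment generating function (Laplace transform) `L(t) = E exp⟨t, X⟩`, with values in
`[0, ∞]`. -/
noncomputable def laplaceTransform {Ω : Type*} [MeasurableSpace Ω] {d : ℕ}
    (X : Ω → EuclideanSpace ℝ (Fin d)) (P : Measure Ω) (t : EuclideanSpace ℝ (Fin d)) : ℝ≥0∞ :=
  ∫⁻ ω, ENNReal.ofReal (Real.exp (inner ℝ t (X ω))) ∂P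

/-- The separation property: `sup_{|t| ≥ t₀} e^{-|t|²/2} E exp⟨t, X⟩ < 1` for every `t₀ > 0`. The
supremum is taken in `[0, ∞]`. -/
def HasSeparationProperty {Ω : Type*} [MeasurableSpace Ω] {d : ℕ}
    (X : Ω → EuclideanSpace ℝ (Fin d)) (P : Measure Ω) : Prop :=
  ∀ t₀ : ℝ, 0 < t₀ →
    (⨆ (t : EuclideanSpace ℝ (Fin d)) (_ : t₀ ≤ ‖t‖),
      ENNReal.ofReal (Real.exp (-‖t‖ ^ 2 / 2)) * laplaceTransform X P t) < 1

/-- The normalized sum `Z_n = (X_1 + ⋯ + X_n) / √n` (the sequence is indexed from `0`). -/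
noncomputable def normalizedSum {Ω : Type*} {d : ℕ}
    (X : ℕ → Ω → EuclideanSpace ℝ (Fin d)) (n : ℕ) (ω : Ω) : EuclideanSpace ℝ (Fin d) :=
  (Real.sqrt n)⁻¹ • ∑ k ∈ Finset.range n, X k ω

/-- The density of a random vector `Z` in `ℝᵈ` with respect to Lebesgue measure, as a real
function (meaningful when `HasPDF Z P volume` holds). -/
noncomputable def densityOf {Ω : Type*} [MeasurableSpace Ω] {d : ℕ}
    (Z : Ω → EuclideanSpace ℝ (Fin d)) (P : Measure Ω) (x : EuclideanSpace ℝ (Fin d)) : ℝ :=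
  (pdf Z P volume x).toReal

/-!
Only an upper bound on the densities has to be proved: since `p_n` and `φ` both have integral `1`,
`T_∞(p_n‖φ) ≥ 0` holds automatically (`tsallisInf_densityOf_nonneg`). The bound is
`p_n ≤ (1 + ε) φ` almost everywhere for large `n`, and it comes from exponential tilting.

Let `Λ(h, s) = E e^{⟨h, X⟩ - 2πi⟨X, s⟩}`. The tilted law `e^{⟨h, z⟩} p_n(z) dz` of `Z_n` has Fourier
transform `Λ(h/√n, s/√n)^n`, so it has a density bounded by the `L¹` norm of this function
(`le_smul_volume_of_lintegral_fourierLaplace_ne_top`). If that norm is at most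
`(1 + ε) (2π)^{-d/2} e^{|h|²/2}` for every `h`, then taking `h = z` in the bound for
`e^{⟨h, z⟩} p_n(z)` gives `p_n(z) ≤ (1 + ε) φ(z)`
(`hasPDF_and_pdf_le_of_lintegral_fourierLaplace_le`).

After rescaling, it remains to estimate `n^{d/2} ∫ a(h, s)^n ds` uniformly in `h`, where
`a(h, s) = e^{-|h|²/2} |Λ(h, s)| ≤ 1` (`eventually_lintegral_fourierLaplace_le`).
* For small `h` and `s`, symmetrization and a second-order expansion in `s` give
  `a(h, s) ≤ e^{-(1 - η) 2π² |s|²}`, where the separation property supplies `L(h) ≤ e^{|h|²/2}`, so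
  that no expansion in `h` is needed (`exists_fourierLaplace_le_gaussian`). This part contributes the
  main term, a Gaussian integral.
* For small `h` and `s` bounded away from `0`, `a` is bounded away from `1` by the Riemann–Lebesgue
  lemma, strict convexity, and continuity in `h` uniform in `s`
  (`exists_fourierLaplace_le_of_le_norm`).
* For `h` bounded away from `0`, `a` is bounded away from `1` by the separation property.

In the last two regions `a^n ≤ δ^{n - 2n₀} a^{2n₀}` with `δ < 1`, and `∫ a(h, s)^{2n₀} ds` is bounded
uniformly in `h`: the bound `p_{n₀} ≤ K φ` makes the tilted law of `Z_{n₀}` bounded by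
`K (2π)^{-d/2} e^{|h|²/2}`, and the `L²` norm of its Fourier transform is controlled by this bound and
by the total mass (`lintegral_sq_fourierLaplace_le`, `lintegral_fourierLaplace_pow_le`).
-/

/-! ### Measures with bounded density and their Fourier transforms -/

section FourierBounds

open Real FourierTransform

open scoped RealInnerProductSpace

variable {V : Type*} [NormedAddCommGroup V] [InnerProductSpace ℝ V] [MeasurableSpace V]

/-- The Fourier–Laplace transform `Λ(h, s) = ∫ e^{⟨h, x⟩} e^{-2πi⟨x, s⟩} dμ(x)` of a measure `μ`.
The factor `2π` in the frequency makes the Fourier inversion formula free of constants. -/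
noncomputable def fourierLaplace (μ : Measure V) (h s : V) : ℂ :=
  VectorFourier.fourierIntegral 𝐞 μ (innerₗ V) (fun x => (rexp ⟪h, x⟫ : ℂ)) s

theorem fourierLaplace_eq (μ : Measure V) (h s : V) :
    fourierLaplace μ h s = ∫ x, (𝐞 (-⟪x, s⟫) : ℂ) * (rexp ⟪h, x⟫ : ℂ) ∂μ := rfl

theorem fourierLaplace_zero_eq (ν : Measure V) (s : V) :
    fourierLaplace ν 0 s = ∫ x, (𝐞 (-⟪x, s⟫) : ℂ) ∂ν := by
  simp [fourierLaplace_eq]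

theorem norm_fourierLaplace_le (μ : Measure V) (h s : V) :
    ‖fourierLaplace μ h s‖ ≤ ∫ x, rexp ⟪h, x⟫ ∂μ := by
  refine (VectorFourier.norm_fourierIntegral_le_integral_norm _ _ _ _ _).trans (le_of_eq ?_)
  refine integral_congr_ae (Eventually.of_forall fun x => ?_)
  simp only [Complex.norm_real, Real.norm_eq_abs, abs_of_pos (Real.exp_pos _)]

variable [BorelSpace V]

theorem continuous_fourierLaplace {μ : Measure V} {h : V}
    (hi : Integrable (fun x => rexp ⟪h, x⟫) μ) : Continuous (fourierLaplace μ h) :=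
  VectorFourier.fourierIntegral_continuous continuous_fourierChar
    (by simpa using! continuous_inner) hi.ofReal

variable [FiniteDimensional ℝ V]

theorem fourierLaplace_withDensity (μ : Measure V) (h s : V) :
    fourierLaplace (μ.withDensity fun x => ENNReal.ofReal (rexp ⟪h, x⟫)) 0 s
      = fourierLaplace μ h s := by
  rw [fourierLaplace_zero_eq, fourierLaplace_eq,
    integral_withDensity_eq_integral_toReal_smul (by fun_prop) (by simp)]
  refine integral_congr_ae (Eventually.of_forall fun x => ?_)
  simp only [ENNReal.toReal_ofReal (Real.exp_pos _).le, Complex.real_smul, mul_comm]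

/-- A finite measure whose Fourier transform has finite `L¹` norm `A` is at most `A` times Lebesgue
measure: this is the bound `‖q‖_∞ ≤ ‖q̂‖₁` without assuming a density `q` beforehand. -/
theorem le_smul_volume_of_lintegral_fourierLaplace_ne_top (ν : Measure V) [IsFiniteMeasure ν]
    (hA : ∫⁻ s, ‖fourierLaplace ν 0 s‖ₑ ≠ ⊤) :
    ν ≤ (∫⁻ s, ‖fourierLaplace ν 0 s‖ₑ) • (volume : Measure V) := by
  set A := ∫⁻ s, ‖fourierLaplace ν 0 s‖ₑ with hAdef
  have hFint : Integrable (fourierLaplace ν 0) :=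
    ⟨(continuous_fourierLaplace (by simp)).aestronglyMeasurable, lt_top_iff_ne_top.2 hA⟩
  have hL : Continuous fun p : V × V => (innerₗ V) p.1 p.2 := by simpa using! continuous_inner
  have hL' : Continuous fun p : V × V => (-innerₗ V) p.1 p.2 := by
    simpa using! continuous_inner.neg
  -- Fubini twice: `∫ ψ dν = ∫ 𝓕(𝓕⁻ψ) dν = ∫ 𝓕⁻ψ · ν̂ = ∫ ψ · 𝓕⁻(ν̂)`.
  have key (ψ : SchwartzMap V ℂ) : ‖∫ x, ψ x ∂ν‖ₑ ≤ A * ∫⁻ x, ‖ψ x‖ₑ := by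
    have e1 : ∫ x, ψ x ∂ν = ∫ s, (𝓕⁻ ψ) s • fourierLaplace ν 0 s := by
      have := VectorFourier.integral_fourierIntegral_smul_eq_flip (e := 𝐞) (μ := volume)
        (ν := ν) (L := innerₗ V) (f := (𝓕⁻ ψ : SchwartzMap V ℂ)) (g := fun _ => (1 : ℂ))
        continuous_fourierChar hL (𝓕⁻ ψ).integrable (integrable_const _)
      calc ∫ x, ψ x ∂ν = ∫ x, (𝓕 (𝓕⁻ ψ) : SchwartzMap V ℂ) x ∂ν := by simp
        _ = _ := by
          rw [SchwartzMap.fourier_coe]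
          simp only [smul_eq_mul, mul_one] at this
          refine this.trans (integral_congr_ae (Eventually.of_forall fun s => ?_))
          simp [fourierLaplace, flip_innerₗ]
    have e2 : ∫ s, (𝓕⁻ ψ) s • fourierLaplace ν 0 s =
        ∫ x, ψ x • VectorFourier.fourierIntegral 𝐞 volume (-innerₗ V).flip
          (fourierLaplace ν 0) x := by
      rw [← VectorFourier.integral_fourierIntegral_smul_eq_flip (e := 𝐞) (μ := volume)
        (ν := volume) (L := -innerₗ V) (f := ψ) continuous_fourierChar hL' ψ.integrable hFint,
        SchwartzMap.fourierInv_coe]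
      refine integral_congr_ae (Eventually.of_forall fun s => ?_)
      rfl
    rw [e1, e2]
    calc _ ≤ ∫⁻ x, ‖ψ x • VectorFourier.fourierIntegral 𝐞 volume (-innerₗ V).flip
          (fourierLaplace ν 0) x‖ₑ := enorm_integral_le_lintegral_enorm _
      _ ≤ ∫⁻ x, A * ‖ψ x‖ₑ := by
          refine lintegral_mono fun x => ?_
          rw [enorm_smul, mul_comm]
          gcongr
          refine (enorm_integral_le_lintegral_enorm _).trans (le_of_eq ?_)
          refine lintegral_congr fun s => ?_
          rw [Circle.smul_def, enorm_smul, ← ofReal_norm, Circle.norm_coe, ENNReal.ofReal_one,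
            one_mul]
      _ = A * ∫⁻ x, ‖ψ x‖ₑ := by rw [lintegral_const_mul _ (by fun_prop)]
  -- Comparison on open sets, by smooth functions between `𝟙_K` and `𝟙_U`.
  have hopen (U : Set V) (hU : IsOpen U) : ν U ≤ A * volume U := by
    rw [hU.measure_eq_iSup_isCompact]
    refine iSup₂_le fun K hKU => iSup_le fun hK => ?_
    obtain ⟨W, hWo, hKW, hWU, hWc⟩ := exists_open_between_and_isCompact_closure hK hU hKU
    obtain ⟨f, hf, hfr, hfs, hfK⟩ := exists_contMDiff_support_eq_eq_one_iff
      (modelWithCornersSelf ℝ V) (n := ⊤) hWo hK.isClosed hKW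
    have hf0 (x : V) : 0 ≤ f x := (hfr ⟨x, rfl⟩).1
    have hf1 (x : V) : f x ≤ 1 := (hfr ⟨x, rfl⟩).2
    have hcs : HasCompactSupport (fun x => (f x : ℂ)) := by
      refine HasCompactSupport.intro hWc fun x hx => ?_
      have : x ∉ Function.support f := fun h => hx (subset_closure (hfs ▸ h))
      simpa using this
    have hcd : ContDiff ℝ ((⊤ : ℕ∞) : WithTop ℕ∞) (fun x => (f x : ℂ)) :=
      Complex.ofRealCLM.contDiff.comp hf.contDiff
    set ψ := hcs.toSchwartzMap hcd with hψ
    have hψx (x : V) : ψ x = (f x : ℂ) := rfl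
    have hψe (x : V) : ‖ψ x‖ₑ = ENNReal.ofReal (f x) := by
      rw [hψx, ← ofReal_norm, Complex.norm_real, Real.norm_of_nonneg (hf0 x)]
    calc ν K = ∫⁻ x, K.indicator 1 x ∂ν := by rw [lintegral_indicator_one hK.measurableSet]
      _ ≤ ∫⁻ x, ENNReal.ofReal (f x) ∂ν := by
          refine lintegral_mono fun x => ?_
          by_cases hx : x ∈ K
          · simp [hx, (hfK x).1 hx]
          · simp [hx]
      _ = ENNReal.ofReal (∫ x, f x ∂ν) := by
          refine (ofReal_integral_eq_lintegral_ofReal ?_ (Eventually.of_forall hf0)).symm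
          refine Integrable.of_bound hf.continuous.aestronglyMeasurable 1
            (Eventually.of_forall fun x => ?_)
          rw [Real.norm_of_nonneg (hf0 x)]; exact hf1 x
      _ = ‖∫ x, ψ x ∂ν‖ₑ := by
          simp_rw [hψx]
          rw [integral_complex_ofReal, ← ofReal_norm, Complex.norm_real,
            Real.norm_of_nonneg (integral_nonneg hf0)]
      _ ≤ A * ∫⁻ x, ‖ψ x‖ₑ := key ψ
      _ ≤ A * ∫⁻ x, U.indicator 1 x := by
          gcongr with x
          rw [hψe]
          by_cases hx : x ∈ U
          · simpa [hx] using hf1 x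
          · have : x ∉ Function.support f := fun h => hx (hWU (subset_closure (hfs ▸ h)))
            simp [hx, Function.notMem_support.1 this]
      _ = A * volume U := by rw [lintegral_indicator_one hU.measurableSet]
  refine Measure.le_iff.2 fun S _ => ?_
  rw [Measure.smul_apply, smul_eq_mul]
  rcases eq_or_ne A 0 with h0 | h0
  · rw [h0, zero_mul]
    refine (measure_mono (Set.subset_univ S)).trans ((hopen _ isOpen_univ).trans ?_)
    simp [h0]
  · rw [S.measure_eq_iInf_isOpen volume, ENNReal.mul_iInf_of_ne h0 hA]
    refine le_iInf fun U => ?_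
    by_cases hSU : S ⊆ U
    · by_cases hU : IsOpen U
      · simpa [hSU, hU] using (measure_mono hSU).trans (hopen U hU)
      · simp [hSU, hU, h0]
    · simp [hSU, h0]

theorem lintegral_enorm_fourier_gaussian {b : ℝ} (hb : 0 < b) :
    ∫⁻ w : V, ‖𝓕 (fun v : V => Complex.exp (-(b : ℂ) * ‖v‖ ^ 2)) w‖ₑ = 1 := by
  have hn (w : V) : ‖𝓕 (fun v : V => Complex.exp (-(b : ℂ) * ‖v‖ ^ 2)) w‖ =
      (π / b) ^ (Module.finrank ℝ V / 2 : ℝ) * rexp (-(π ^ 2 / b) * ‖w‖ ^ 2) := by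
    rw [fourier_gaussian_innerProductSpace (by simpa using hb), norm_mul, Complex.norm_exp]
    congr 1
    · rw [← Complex.ofReal_div]
      have : (Module.finrank ℝ V / 2 : ℂ) = ((Module.finrank ℝ V / 2 : ℝ) : ℂ) := by simp
      rw [this, ← Complex.ofReal_cpow (by positivity), Complex.norm_real, Real.norm_of_nonneg
        (by positivity)]
    · congr 1
      have : (-(π : ℂ) ^ 2 * ‖w‖ ^ 2 / b) = ((-(π ^ 2 / b) * ‖w‖ ^ 2 : ℝ) : ℂ) := by
        push_cast; ring
      rw [this, Complex.ofReal_re]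
  have hI : ∫ w : V, (π / b) ^ (Module.finrank ℝ V / 2 : ℝ) * rexp (-(π ^ 2 / b) * ‖w‖ ^ 2)
      = 1 := by
    rw [integral_const_mul, GaussianFourier.integral_rexp_neg_mul_sq_norm (by positivity),
      ← Real.mul_rpow (by positivity) (by positivity)]
    have : π / b * (π / (π ^ 2 / b)) = 1 := by field_simp
    rw [this, Real.one_rpow]
  simp_rw [← ofReal_norm, hn]
  rw [← ofReal_integral_eq_lintegral_ofReal, hI, ENNReal.ofReal_one]
  · by_contra h
    rw [integral_undef h] at hI
    exact zero_ne_one hI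
  · exact Eventually.of_forall fun w => by positivity

/-- The bound `‖q̂‖₂² ≤ ‖q‖_∞ ‖q‖₁` for a finite measure with a bounded density `q`, proved by
regularizing with a Gaussian `G`, for which `‖𝓕 G‖₁ = 1`. -/
theorem lintegral_sq_fourierLaplace_le (ν : Measure V) [IsFiniteMeasure ν] (M : ℝ≥0∞)
    (hM : ν ≤ M • (volume : Measure V)) :
    ∫⁻ s, ‖fourierLaplace ν 0 s‖ₑ ^ 2 ≤ M * ν Set.univ := by
  have hL : Continuous fun p : V × V => (innerₗ V) p.1 p.2 := by simpa using! continuous_inner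
  have hL' : Continuous fun p : V × V => (-innerₗ V) p.1 p.2 := by
    simpa using! continuous_inner.neg
  have hFc : Continuous (fourierLaplace ν 0) := continuous_fourierLaplace (by simp)
  have hFb (s : V) : ‖fourierLaplace ν 0 s‖ ≤ ν.real Set.univ := by
    simpa using norm_fourierLaplace_le ν 0 s
  have hconj (s : V) : (starRingEnd ℂ) (fourierLaplace ν 0 s) =
      VectorFourier.fourierIntegral 𝐞 ν (-innerₗ V) (fun _ => (1 : ℂ)) s := by
    rw [fourierLaplace_zero_eq, ← integral_conj, VectorFourier.fourierIntegral]
    refine integral_congr_ae (Eventually.of_forall fun x => ?_)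
    simp [Circle.smul_def, ← Circle.coe_inv_eq_conj, ← AddChar.map_neg_eq_inv]
  have key (b : ℝ) (hb : 0 < b) :
      ∫⁻ s : V, ‖fourierLaplace ν 0 s‖ₑ ^ 2 * ENNReal.ofReal (rexp (-b * ‖s‖ ^ 2))
        ≤ M * ν Set.univ := by
    set G : V → ℂ := fun v => Complex.exp (-(b : ℂ) * ‖v‖ ^ 2) with hG
    have hGint : Integrable G := by
      simpa [hG] using GaussianFourier.integrable_cexp_neg_mul_sq_norm_add
        (b := (b : ℂ)) (by simpa using hb) 0 (0 : V)
    set g : V → ℂ := fun s => (starRingEnd ℂ) (fourierLaplace ν 0 s) * G s with hg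
    have hgint : Integrable g := by
      refine hGint.bdd_mul (c := ν.real Set.univ) ?_ (Eventually.of_forall fun s => ?_)
      · exact (Complex.continuous_conj.comp hFc).aestronglyMeasurable
      · simpa using hFb s
    have hg_fourier (x : V) : VectorFourier.fourierIntegral 𝐞 volume (innerₗ V).flip g x =
        ∫ y, 𝓕 G (x - y) ∂ν := by
      have hg' : Integrable (fun s : V => (𝐞 (-⟪s, x⟫) : ℂ) * G s) := by
        refine hGint.bdd_mul (c := 1) ?_ (Eventually.of_forall fun s => (Circle.norm_coe _).le)
        have : Continuous fun s : V => (𝐞 (-⟪s, x⟫) : ℂ) := by fun_prop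
        exact this.aestronglyMeasurable
      have := VectorFourier.integral_fourierIntegral_smul_eq_flip (e := 𝐞) (μ := ν)
        (ν := volume) (L := -innerₗ V) (f := fun _ => (1 : ℂ)) continuous_fourierChar hL'
        (integrable_const _) hg'
      calc _ = ∫ s, VectorFourier.fourierIntegral 𝐞 ν (-innerₗ V) (fun _ => (1 : ℂ)) s •
            ((𝐞 (-⟪s, x⟫) : ℂ) * G s) := by
            refine integral_congr_ae (Eventually.of_forall fun s => ?_)
            simp only [hg, hconj, Circle.smul_def, smul_eq_mul, LinearMap.flip_apply,
              innerₗ_apply_apply]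
            rw [real_inner_comm]; ring
        _ = _ := by
            rw [this]
            refine integral_congr_ae (Eventually.of_forall fun y => ?_)
            simp only [one_smul]
            rw [Real.fourier_eq]
            refine integral_congr_ae (Eventually.of_forall fun s => ?_)
            simp only [Circle.smul_def, smul_eq_mul, LinearMap.flip_apply, LinearMap.neg_apply,
              innerₗ_apply_apply, neg_neg]
            rw [← mul_assoc, ← Circle.coe_mul, ← AddChar.map_add_eq_mul, inner_sub_right,
              real_inner_comm]
            congr 4
            ring
    have hbound (x : V) : ‖∫ y, 𝓕 G (x - y) ∂ν‖ₑ ≤ M := by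
      calc _ ≤ ∫⁻ y, ‖𝓕 G (x - y)‖ₑ ∂ν := enorm_integral_le_lintegral_enorm _
        _ ≤ ∫⁻ y, ‖𝓕 G (x - y)‖ₑ ∂(M • (volume : Measure V)) := lintegral_mono' hM le_rfl
        _ = M * ∫⁻ y, ‖𝓕 G (x - y)‖ₑ := by rw [lintegral_smul_measure, smul_eq_mul]
        _ = M := by
          rw [lintegral_sub_left_eq_self (fun y => ‖𝓕 G y‖ₑ) x,
            lintegral_enorm_fourier_gaussian hb, mul_one]
    have hswap : ∫ s, fourierLaplace ν 0 s • g s = ∫ x, ∫ y, 𝓕 G (x - y) ∂ν ∂ν := by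
      have := VectorFourier.integral_fourierIntegral_smul_eq_flip (e := 𝐞) (μ := ν)
        (ν := volume) (L := innerₗ V) (f := fun _ => (1 : ℂ)) (g := g) continuous_fourierChar hL
        (integrable_const _) hgint
      simp only [one_smul, hg_fourier] at this
      simpa [fourierLaplace] using this
    have hpt (s : V) : fourierLaplace ν 0 s • g s =
        ((‖fourierLaplace ν 0 s‖ ^ 2 * rexp (-b * ‖s‖ ^ 2) : ℝ) : ℂ) := by
      simp only [hg, hG, smul_eq_mul]
      rw [← mul_assoc, Complex.mul_conj, Complex.normSq_eq_norm_sq]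
      push_cast
      rfl
    calc _ = ∫⁻ s : V, ENNReal.ofReal (‖fourierLaplace ν 0 s‖ ^ 2 * rexp (-b * ‖s‖ ^ 2)) := by
          refine lintegral_congr fun s => ?_
          rw [ENNReal.ofReal_mul (by positivity), ENNReal.ofReal_pow (by positivity), ofReal_norm]
      _ = ENNReal.ofReal (∫ s : V, ‖fourierLaplace ν 0 s‖ ^ 2 * rexp (-b * ‖s‖ ^ 2)) := by
          refine (ofReal_integral_eq_lintegral_ofReal ?_
            (Eventually.of_forall fun s => by positivity)).symm
          refine (((hgint.bdd_mul (c := ν.real Set.univ) hFc.aestronglyMeasurable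
            (Eventually.of_forall hFb)).re).congr (Eventually.of_forall fun s => ?_))
          have := hpt s
          rw [smul_eq_mul] at this
          simp only [this]
          exact Complex.ofReal_re _
      _ = ‖∫ s, fourierLaplace ν 0 s • g s‖ₑ := by
          simp_rw [hpt]
          rw [integral_complex_ofReal, ← ofReal_norm, Complex.norm_real,
            Real.norm_of_nonneg (integral_nonneg fun s => by positivity)]
      _ ≤ ∫⁻ x, ‖∫ y, 𝓕 G (x - y) ∂ν‖ₑ ∂ν := by
          rw [hswap]; exact enorm_integral_le_lintegral_enorm _
      _ ≤ ∫⁻ _, M ∂ν := lintegral_mono hbound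
      _ = M * ν Set.univ := lintegral_const _
  have hlim (s : V) : Tendsto (fun n : ℕ => ‖fourierLaplace ν 0 s‖ₑ ^ 2 *
      ENNReal.ofReal (rexp (-(1 / ((n : ℝ) + 1)) * ‖s‖ ^ 2))) atTop
      (𝓝 (‖fourierLaplace ν 0 s‖ₑ ^ 2)) := by
    have h1 : Tendsto (fun n : ℕ => rexp (-(1 / ((n : ℝ) + 1)) * ‖s‖ ^ 2)) atTop (𝓝 1) := by
      have h0 := (tendsto_one_div_add_atTop_nhds_zero_nat (𝕜 := ℝ)).neg.mul_const (‖s‖ ^ 2)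
      exact (Real.continuous_exp.tendsto' _ 1 (by simp)).comp h0
    have h2 := ENNReal.Tendsto.const_mul (a := ‖fourierLaplace ν 0 s‖ₑ ^ 2)
      (ENNReal.tendsto_ofReal h1) (Or.inl (by simp))
    simpa using h2
  calc ∫⁻ s, ‖fourierLaplace ν 0 s‖ₑ ^ 2
      = ∫⁻ s, liminf (fun n : ℕ => ‖fourierLaplace ν 0 s‖ₑ ^ 2 *
          ENNReal.ofReal (rexp (-(1 / ((n : ℝ) + 1)) * ‖s‖ ^ 2))) atTop :=
        lintegral_congr fun s => (hlim s).liminf_eq.symm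
    _ ≤ liminf (fun n : ℕ => ∫⁻ s, ‖fourierLaplace ν 0 s‖ₑ ^ 2 *
          ENNReal.ofReal (rexp (-(1 / ((n : ℝ) + 1)) * ‖s‖ ^ 2))) atTop :=
        lintegral_liminf_le fun n => by
          have := hFc.measurable
          fun_prop
    _ ≤ M * ν Set.univ :=
        liminf_le_of_frequently_le' (Eventually.of_forall fun n => key _ (by positivity)).frequently

end FourierBounds

/-! ### The Fourier–Laplace transform near the origin -/

section LowFrequencies

open Real FourierTransform

open scoped RealInnerProductSpace

theorem sq_div_two_sub_le_one_sub_cos (w : ℝ) : w ^ 2 / 2 - w ^ 4 / 2 ≤ 1 - Real.cos w := by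
  rcases le_or_gt |w| 1 with h | h
  · have h1 := (abs_le.1 (Real.cos_bound h)).2
    have h2 : |w| ^ 4 = w ^ 4 := by rw [← abs_pow, abs_of_nonneg (by positivity)]
    nlinarith [show 0 ≤ w ^ 4 by positivity]
  · have h1 : 1 ≤ w ^ 2 := by nlinarith [sq_abs w]
    nlinarith [Real.cos_le_one w]

variable {V : Type*} [NormedAddCommGroup V] [InnerProductSpace ℝ V]

/-- Pointwise form of the second-order expansion. The factor `r` in the error term comes with
`‖s‖ ^ 2`, so that the error is negligible against the main term, whose mean is of order
`‖s‖ ^ 2`. -/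
theorem exp_mul_one_sub_cos_ge {r : ℝ} (hr1 : r ≤ 1) {h s : V} (hh : ‖h‖ ≤ r)
    (hs : ‖s‖ ≤ r) (x y : V) :
    (2 * π * (⟪x, s⟫ - ⟪y, s⟫)) ^ 2 / 2 - (2 * π) ^ 2 * ((2 * π) ^ 2 + 1) * r * ‖s‖ ^ 2 *
      (1 + 16 * (‖x‖ ^ 4 + ‖y‖ ^ 4)) ≤
    rexp ⟪h, x⟫ * rexp ⟪h, y⟫ * (1 - Real.cos (2 * π * (⟪x, s⟫ - ⟪y, s⟫))) := by
  have hr0 : 0 ≤ r := (norm_nonneg h).trans hh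
  set R := ‖x‖ + ‖y‖ with hR
  set w := 2 * π * (⟪x, s⟫ - ⟪y, s⟫) with hw
  have hR0 : 0 ≤ R := by positivity
  have hu : |⟪h, x⟫ + ⟪h, y⟫| ≤ r * R := by
    rw [← inner_add_right]
    refine (abs_real_inner_le_norm _ _).trans ?_
    exact mul_le_mul hh (norm_add_le _ _) (norm_nonneg _) hr0
  have hwR : w ^ 2 ≤ (2 * π) ^ 2 * ‖s‖ ^ 2 * R ^ 2 := by
    have h1 : |⟪x, s⟫ - ⟪y, s⟫| ≤ ‖s‖ * R := by
      rw [← inner_sub_left, mul_comm]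
      refine (abs_real_inner_le_norm _ _).trans ?_
      exact mul_le_mul_of_nonneg_right (norm_sub_le _ _) (norm_nonneg _)
    have h2 : (⟪x, s⟫ - ⟪y, s⟫) ^ 2 ≤ (‖s‖ * R) ^ 2 := sq_le_sq' (abs_le.1 h1).1 (abs_le.1 h1).2
    calc w ^ 2 = (2 * π) ^ 2 * (⟪x, s⟫ - ⟪y, s⟫) ^ 2 := by rw [hw]; ring
      _ ≤ (2 * π) ^ 2 * (‖s‖ * R) ^ 2 := by gcongr
      _ = _ := by ring
  have hc0 : 0 ≤ 1 - Real.cos w := by linarith [Real.cos_le_one w]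
  have hc2 : 1 - Real.cos w ≤ w ^ 2 / 2 := by linarith [Real.one_sub_sq_div_two_le_cos (x := w)]
  -- The lower bound may be negative; it only gets multiplied by `1 - cos w ≥ 0`.
  have hexp : 1 - r * R ≤ rexp ⟪h, x⟫ * rexp ⟪h, y⟫ := by
    rw [← Real.exp_add]
    linarith [Real.add_one_le_exp (⟪h, x⟫ + ⟪h, y⟫), (abs_le.1 hu).1]
  have hRK : R ^ 4 ≤ 8 * (‖x‖ ^ 4 + ‖y‖ ^ 4) := by
    have := add_pow_le (norm_nonneg x) (norm_nonneg y) 4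
    norm_num at this
    exact this
  have hR3 : R ^ 3 ≤ 1 + R ^ 4 := by
    nlinarith [sq_nonneg (R ^ 2 - R), sq_nonneg (R - 1), sq_nonneg (R ^ 2 - 1)]
  have hrw : w ^ 4 ≤ w ^ 2 * ((2 * π) ^ 2 * r * R ^ 2) := by
    have : ‖s‖ ^ 2 ≤ r := by nlinarith [norm_nonneg s]
    calc w ^ 4 = w ^ 2 * w ^ 2 := by ring
      _ ≤ w ^ 2 * ((2 * π) ^ 2 * ‖s‖ ^ 2 * R ^ 2) := by gcongr
      _ ≤ _ := by gcongr
  have herr : w ^ 4 / 2 + r * R * (w ^ 2 / 2) ≤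
      (2 * π) ^ 2 * ((2 * π) ^ 2 + 1) * r * ‖s‖ ^ 2 * (1 + 16 * (‖x‖ ^ 4 + ‖y‖ ^ 4)) := by
    calc w ^ 4 / 2 + r * R * (w ^ 2 / 2)
        ≤ w ^ 2 * ((2 * π) ^ 2 * r * R ^ 2) / 2 + r * R * (w ^ 2 / 2) := by gcongr
      _ = w ^ 2 * (r * ((2 * π) ^ 2 * R ^ 2 + R) / 2) := by ring
      _ ≤ (2 * π) ^ 2 * ‖s‖ ^ 2 * R ^ 2 * (r * ((2 * π) ^ 2 * R ^ 2 + R) / 2) := by gcongr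
      _ = (2 * π) ^ 2 * r * ‖s‖ ^ 2 * (((2 * π) ^ 2 * R ^ 4 + R ^ 3) / 2) := by ring
      _ ≤ (2 * π) ^ 2 * r * ‖s‖ ^ 2 * (((2 * π) ^ 2 + 1) * (1 + 16 * (‖x‖ ^ 4 + ‖y‖ ^ 4))) := by
        gcongr
        have hR4 : 0 ≤ R ^ 4 := by positivity
        have := mul_nonneg (sq_nonneg (2 * π))
          (show 0 ≤ 1 + 16 * (‖x‖ ^ 4 + ‖y‖ ^ 4) - R ^ 4 / 2 by linarith)
        linarith
      _ = _ := by ring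
  calc _ ≤ w ^ 2 / 2 - (w ^ 4 / 2 + r * R * (w ^ 2 / 2)) := by linarith
    _ ≤ (1 - Real.cos w) - r * R * (1 - Real.cos w) := by
      have := sq_div_two_sub_le_one_sub_cos w
      have := mul_le_mul_of_nonneg_left hc2 (mul_nonneg hr0 hR0)
      linarith
    _ = (1 - r * R) * (1 - Real.cos w) := by ring
    _ ≤ _ := mul_le_mul_of_nonneg_right hexp hc0

variable [MeasurableSpace V] [FiniteDimensional ℝ V] {μ : Measure V} [IsProbabilityMeasure μ]

theorem integral_sq_inner_sub_inner (h4 : MemLp id 4 μ)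
    (hmean : ∀ s : V, ∫ x, ⟪x, s⟫ ∂μ = 0) (hvar : ∀ s : V, ∫ x, ⟪x, s⟫ ^ 2 ∂μ = ‖s‖ ^ 2) (s : V) :
    Integrable (fun z : V × V => (2 * π * (⟪z.1, s⟫ - ⟪z.2, s⟫)) ^ 2 / 2) (μ.prod μ) ∧
    ∫ z : V × V, (2 * π * (⟪z.1, s⟫ - ⟪z.2, s⟫)) ^ 2 / 2 ∂(μ.prod μ) = 4 * π ^ 2 * ‖s‖ ^ 2 := by
  have h2 : MemLp id 2 μ := h4.mono_exponent (by norm_num)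
  have hl : MemLp (fun x : V => ⟪x, s⟫) 2 μ := h2.inner_const s
  have i1 : Integrable (fun x : V => ⟪x, s⟫) μ := hl.integrable (by norm_num)
  have i2 : Integrable (fun x : V => ⟪x, s⟫ ^ 2) μ := hl.integrable_sq
  have j1 := (i2.mul_prod (integrable_const (1 : ℝ)) : Integrable _ (μ.prod μ))
  have j2 := ((integrable_const (1 : ℝ)).mul_prod i2 : Integrable _ (μ.prod μ))
  have j3 := i1.mul_prod i1
  have e (z : V × V) : (2 * π * (⟪z.1, s⟫ - ⟪z.2, s⟫)) ^ 2 / 2 = 2 * π ^ 2 *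
      ((⟪z.1, s⟫ ^ 2 * 1 + 1 * ⟪z.2, s⟫ ^ 2) - 2 * (⟪z.1, s⟫ * ⟪z.2, s⟫)) := by ring
  simp_rw [e]
  have j4 : Integrable (fun z : V × V => ⟪z.1, s⟫ ^ 2 * 1 + 1 * ⟪z.2, s⟫ ^ 2) (μ.prod μ) :=
    j1.add j2
  refine ⟨(j4.sub (j3.const_mul 2)).const_mul _, ?_⟩
  rw [integral_const_mul, integral_sub j4 (j3.const_mul 2), integral_const_mul,
    integral_add j1 j2,
    integral_prod_mul (μ := μ) (ν := μ) (fun x : V => ⟪x, s⟫) (fun x : V => ⟪x, s⟫),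
    integral_prod_mul (μ := μ) (ν := μ) (fun x : V => ⟪x, s⟫ ^ 2) (fun _ : V => (1 : ℝ)),
    integral_prod_mul (μ := μ) (ν := μ) (fun _ : V => (1 : ℝ)) (fun x : V => ⟪x, s⟫ ^ 2),
    hmean, hvar]
  simp
  ring

variable [BorelSpace V]

/-- Symmetrization: `L(h)² - |Λ(h, s)|²` as a double integral of a nonnegative function. -/
theorem sq_integral_exp_sub_sq_norm_fourierLaplace {h : V}
    (hexp : Integrable (fun x => rexp ⟪h, x⟫) μ) (s : V) :
    Integrable (fun z : V × V => rexp ⟪h, z.1⟫ * rexp ⟪h, z.2⟫ *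
      (1 - Real.cos (2 * π * (⟪z.1, s⟫ - ⟪z.2, s⟫)))) (μ.prod μ) ∧
    (∫ x, rexp ⟪h, x⟫ ∂μ) ^ 2 - ‖fourierLaplace μ h s‖ ^ 2 =
      ∫ z : V × V, rexp ⟪h, z.1⟫ * rexp ⟪h, z.2⟫ *
        (1 - Real.cos (2 * π * (⟪z.1, s⟫ - ⟪z.2, s⟫))) ∂(μ.prod μ) := by
  set f : V → ℂ := fun x => (𝐞 (-⟪x, s⟫) : ℂ) * (rexp ⟪h, x⟫ : ℂ) with hf
  have hfi : Integrable f μ := by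
    refine hexp.ofReal.bdd_mul (c := 1) ?_ (Eventually.of_forall fun s => (Circle.norm_coe _).le)
    have : Continuous fun x : V => (𝐞 (-⟪x, s⟫) : ℂ) := by fun_prop
    exact this.aestronglyMeasurable
  have hgi : Integrable (fun x => (starRingEnd ℂ) (f x)) μ :=
    (Complex.conjLIE.toContinuousLinearEquiv.toContinuousLinearMap).integrable_comp hfi
  have hre (z : V × V) : (f z.1 * (starRingEnd ℂ) (f z.2)).re =
      rexp ⟪h, z.1⟫ * rexp ⟪h, z.2⟫ * Real.cos (2 * π * (⟪z.1, s⟫ - ⟪z.2, s⟫)) := by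
    have e1 : f z.1 * (starRingEnd ℂ) (f z.2) = ((rexp ⟪h, z.1⟫ * rexp ⟪h, z.2⟫ : ℝ) : ℂ) *
        (𝐞 (-(⟪z.1, s⟫ - ⟪z.2, s⟫)) : ℂ) := by
      have : (𝐞 (-(⟪z.1, s⟫ - ⟪z.2, s⟫)) : ℂ) =
          (𝐞 (-⟪z.1, s⟫) : ℂ) * (starRingEnd ℂ) (𝐞 (-⟪z.2, s⟫) : ℂ) := by
        rw [← Circle.coe_inv_eq_conj, ← AddChar.map_neg_eq_inv, ← Circle.coe_mul,
          ← AddChar.map_add_eq_mul]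
        congr 3; ring
      rw [this]
      simp only [hf, map_mul, Complex.conj_ofReal]
      push_cast; ring
    rw [e1, Complex.re_ofReal_mul, Real.fourierChar_apply, Complex.exp_ofReal_mul_I_re,
      mul_neg, Real.cos_neg]
  have h1 := hfi.mul_prod hgi
  have h2 := hexp.mul_prod hexp
  have h3 : Integrable (fun z : V × V => rexp ⟪h, z.1⟫ * rexp ⟪h, z.2⟫ *
      Real.cos (2 * π * (⟪z.1, s⟫ - ⟪z.2, s⟫))) (μ.prod μ) :=
    h1.re.congr (Eventually.of_forall hre)
  have e2 : ‖fourierLaplace μ h s‖ ^ 2 = ∫ z : V × V, rexp ⟪h, z.1⟫ * rexp ⟪h, z.2⟫ *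
      Real.cos (2 * π * (⟪z.1, s⟫ - ⟪z.2, s⟫)) ∂(μ.prod μ) := by
    have := integral_prod_mul (μ := μ) (ν := μ) f (fun x => (starRingEnd ℂ) (f x))
    rw [integral_conj, ← fourierLaplace_eq, Complex.mul_conj, Complex.normSq_eq_norm_sq] at this
    rw [← Complex.ofReal_re (‖fourierLaplace μ h s‖ ^ 2), ← this]
    refine (integral_re h1).symm.trans (integral_congr_ae (Eventually.of_forall hre))
  have e3 : (∫ x, rexp ⟪h, x⟫ ∂μ) ^ 2 = ∫ z : V × V, rexp ⟪h, z.1⟫ * rexp ⟪h, z.2⟫ ∂(μ.prod μ) := by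
    rw [sq, integral_prod_mul (μ := μ) (ν := μ) (fun x => rexp ⟪h, x⟫) (fun x => rexp ⟪h, x⟫)]
  simp only [mul_sub, mul_one] at *
  exact ⟨h2.sub h3, by rw [e2, e3, integral_sub h2 h3]⟩

/-- Near the origin, `e^{-|h|²/2} |Λ(h, s)|` is bounded by a function arbitrarily close to the
Fourier transform of the standard normal law. No expansion in `h` is needed, as `L(h) ≤ e^{|h|²/2}`
is assumed. -/
theorem exists_fourierLaplace_le_gaussian (hexp : ∀ h : V, Integrable (fun x => rexp ⟪h, x⟫) μ)
    (hle : ∀ h : V, ∫ x, rexp ⟪h, x⟫ ∂μ ≤ rexp (‖h‖ ^ 2 / 2)) (h4 : MemLp id 4 μ)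
    (hmean : ∀ s : V, ∫ x, ⟪x, s⟫ ∂μ = 0) (hvar : ∀ s : V, ∫ x, ⟪x, s⟫ ^ 2 ∂μ = ‖s‖ ^ 2)
    {ε : ℝ} (hε : 0 < ε) :
    ∃ r : ℝ, 0 < r ∧ ∀ h s : V, ‖h‖ ≤ r → ‖s‖ ≤ r →
      rexp (-‖h‖ ^ 2 / 2) * ‖fourierLaplace μ h s‖ ≤ rexp (-((1 - ε) * (2 * π ^ 2)) * ‖s‖ ^ 2) := by
  have hK : Integrable (fun z : V × V => 1 + 16 * (‖z.1‖ ^ 4 + ‖z.2‖ ^ 4)) (μ.prod μ) := by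
    have i4 : Integrable (fun x : V => ‖x‖ ^ 4) μ := by
      simpa using h4.integrable_norm_pow (by norm_num)
    have j1 := (i4.mul_prod (integrable_const (1 : ℝ)) : Integrable _ (μ.prod μ))
    have j2 := ((integrable_const (1 : ℝ)).mul_prod i4 : Integrable _ (μ.prod μ))
    simpa using (integrable_const (1 : ℝ)).add ((j1.add j2).const_mul 16)
  set C := (2 * π) ^ 2 * ((2 * π) ^ 2 + 1) *
    ∫ z : V × V, 1 + 16 * (‖z.1‖ ^ 4 + ‖z.2‖ ^ 4) ∂(μ.prod μ) with hC
  obtain ⟨r, hr0, hr1, hrC, hrε⟩ : ∃ r : ℝ, 0 < r ∧ r ≤ 1 ∧ 0 ≤ 4 * π ^ 2 - r * C ∧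
      4 * π ^ 2 * (1 - ε) ≤ rexp (-r ^ 2) * (4 * π ^ 2 - r * C) := by
    have c1 : Continuous fun r : ℝ => 4 * π ^ 2 - r * C := by fun_prop
    have c2 : Continuous fun r : ℝ => rexp (-r ^ 2) * (4 * π ^ 2 - r * C) := by fun_prop
    have hπ : 0 < 4 * π ^ 2 := by positivity
    have e1 : ∀ᶠ r in 𝓝[>] (0 : ℝ), 0 < 4 * π ^ 2 - r * C :=
      nhdsWithin_le_nhds (c1.continuousAt.eventually_const_lt (by simpa using hπ))
    have e2 : ∀ᶠ r in 𝓝[>] (0 : ℝ),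
        4 * π ^ 2 * (1 - ε) < rexp (-r ^ 2) * (4 * π ^ 2 - r * C) :=
      nhdsWithin_le_nhds (c2.continuousAt.eventually_const_lt (by simp; nlinarith))
    have e3 : ∀ᶠ r in 𝓝[>] (0 : ℝ), r < 1 :=
      nhdsWithin_le_nhds (eventually_lt_nhds one_pos)
    obtain ⟨r, h1, h2, h3, h0⟩ := (e1.and (e2.and (e3.and self_mem_nhdsWithin))).exists
    exact ⟨r, h0, h3.le, h1.le, h2.le⟩
  refine ⟨r, hr0, fun h s hh hs => ?_⟩
  obtain ⟨hi, he⟩ := sq_integral_exp_sub_sq_norm_fourierLaplace (hexp h) s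
  obtain ⟨wi, we⟩ := integral_sq_inner_sub_inner h4 hmean hvar s
  have hki := hK.const_mul ((2 * π) ^ 2 * ((2 * π) ^ 2 + 1) * r * ‖s‖ ^ 2)
  have hlow : (4 * π ^ 2 - r * C) * ‖s‖ ^ 2 ≤
      (∫ x, rexp ⟪h, x⟫ ∂μ) ^ 2 - ‖fourierLaplace μ h s‖ ^ 2 := by
    rw [he]
    refine le_trans (le_of_eq ?_) (integral_mono (wi.sub hki) hi fun z =>
      exp_mul_one_sub_cos_ge hr1 hh hs z.1 z.2)
    change _ = ∫ z : V × V, (2 * π * (⟪z.1, s⟫ - ⟪z.2, s⟫)) ^ 2 / 2 - _ * _ ∂(μ.prod μ)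
    rw [integral_sub wi hki, we, integral_const_mul, hC]
    ring
  have hL2 : (∫ x, rexp ⟪h, x⟫ ∂μ) ^ 2 ≤ rexp (‖h‖ ^ 2) := by
    calc _ ≤ rexp (‖h‖ ^ 2 / 2) ^ 2 :=
          pow_le_pow_left₀ (integral_nonneg fun x => (Real.exp_pos _).le) (hle h) 2
      _ = rexp (‖h‖ ^ 2) := by rw [← Real.exp_nat_mul]; congr 1; push_cast; ring
  rw [← sq_le_sq₀ (by positivity) (by positivity)]
  calc (rexp (-‖h‖ ^ 2 / 2) * ‖fourierLaplace μ h s‖) ^ 2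
      = rexp (-‖h‖ ^ 2) * ‖fourierLaplace μ h s‖ ^ 2 := by
        rw [mul_pow, ← Real.exp_nat_mul]; congr 2; push_cast; ring
    _ ≤ rexp (-‖h‖ ^ 2) * (rexp (‖h‖ ^ 2) - (4 * π ^ 2 - r * C) * ‖s‖ ^ 2) := by
        gcongr; linarith
    _ = 1 - rexp (-‖h‖ ^ 2) * (4 * π ^ 2 - r * C) * ‖s‖ ^ 2 := by
        rw [mul_sub, ← Real.exp_add]; simp; ring
    _ ≤ 1 - rexp (-r ^ 2) * (4 * π ^ 2 - r * C) * ‖s‖ ^ 2 := by gcongr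
    _ ≤ 1 - 4 * π ^ 2 * (1 - ε) * ‖s‖ ^ 2 := by gcongr
    _ ≤ rexp (-(4 * π ^ 2 * (1 - ε) * ‖s‖ ^ 2)) := by
        linarith [Real.add_one_le_exp (-(4 * π ^ 2 * (1 - ε) * ‖s‖ ^ 2))]
    _ = _ := by rw [← Real.exp_nat_mul]; congr 1; push_cast; ring

end LowFrequencies

/-! ### The Fourier–Laplace transform away from the origin in frequency -/

section HighFrequencies

open Real FourierTransform

open scoped RealInnerProductSpace

variable {V : Type*} [NormedAddCommGroup V] [InnerProductSpace ℝ V] [MeasurableSpace V]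
  {μ : Measure V} [IsProbabilityMeasure μ]

section

variable [BorelSpace V]

/-- Continuity of `Λ` in `h` at `0`, uniformly in `s`. The bound comes from
`E (e^{⟨h, X⟩} - 1)² = L(2h) - 2 L(h) + 1`, with `1 ≤ L(h)` and `L(2h) ≤ e^{2|h|²}`. -/
theorem norm_fourierLaplace_sub_le (hexp : ∀ h : V, Integrable (fun x => rexp ⟪h, x⟫) μ)
    (hle : ∀ h : V, ∫ x, rexp ⟪h, x⟫ ∂μ ≤ rexp (‖h‖ ^ 2 / 2)) (h2 : MemLp id 2 μ)
    (hmean : ∀ s : V, ∫ x, ⟪x, s⟫ ∂μ = 0) {η : ℝ} (hη : 0 < η) {h : V}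
    (hh : rexp (2 * ‖h‖ ^ 2) - 1 ≤ η ^ 2) (s : V) :
    ‖fourierLaplace μ h s - fourierLaplace μ 0 s‖ ≤ η := by
  have hLge : 1 ≤ ∫ x, rexp ⟪h, x⟫ ∂μ := by
    have hi : Integrable (fun x : V => ⟪x, h⟫) μ := (h2.inner_const h).integrable (by norm_num)
    calc (1 : ℝ) = ∫ x, ⟪x, h⟫ + 1 ∂μ := by
          rw [integral_add hi (integrable_const _), hmean]; simp
      _ ≤ _ := integral_mono (hi.add (integrable_const _)) (hexp h) fun x => by
          rw [real_inner_comm]; exact Real.add_one_le_exp _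
  have hsq (x : V) : (rexp ⟪h, x⟫ - 1) ^ 2 = rexp ⟪(2 : ℝ) • h, x⟫ - 2 * rexp ⟪h, x⟫ + 1 := by
    have : rexp ⟪(2 : ℝ) • h, x⟫ = rexp ⟪h, x⟫ ^ 2 := by
      rw [← Real.exp_nat_mul, real_inner_smul_left]; norm_num
    rw [this]; ring
  have j : Integrable (fun x => rexp ⟪(2 : ℝ) • h, x⟫ - 2 * rexp ⟪h, x⟫) μ :=
    (hexp _).sub ((hexp h).const_mul 2)
  have isq : Integrable (fun x => (rexp ⟪h, x⟫ - 1) ^ 2) μ := by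
    simp_rw [hsq]
    exact j.add (integrable_const 1)
  have esq : ∫ x, (rexp ⟪h, x⟫ - 1) ^ 2 ∂μ ≤ η ^ 2 := by
    simp_rw [hsq]
    rw [integral_add j (integrable_const _), integral_sub (hexp _) ((hexp h).const_mul 2),
      integral_const_mul]
    have h3 := hle ((2 : ℝ) • h)
    have h4 : ‖(2 : ℝ) • h‖ ^ 2 / 2 = 2 * ‖h‖ ^ 2 := by
      rw [norm_smul, Real.norm_ofNat]; ring
    rw [h4] at h3
    simp only [integral_const, probReal_univ, smul_eq_mul]
    linarith
  have hb (h : V) : Integrable (fun x => (𝐞 (-⟪x, s⟫) : ℂ) * (rexp ⟪h, x⟫ : ℂ)) μ := by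
    refine (hexp h).ofReal.bdd_mul (c := 1) ?_
      (Eventually.of_forall fun s => (Circle.norm_coe _).le)
    have : Continuous fun x : V => (𝐞 (-⟪x, s⟫) : ℂ) := by fun_prop
    exact this.aestronglyMeasurable
  rw [fourierLaplace_eq, fourierLaplace_eq, ← integral_sub (hb h) (hb 0)]
  calc _ ≤ ∫ x, (η + (rexp ⟪h, x⟫ - 1) ^ 2 / η) / 2 ∂μ := by
        refine norm_integral_le_of_norm_le
          (((integrable_const _).add (isq.div_const η)).div_const 2)
          (Eventually.of_forall fun x => ?_)
        have e : (𝐞 (-⟪x, s⟫) : ℂ) * (rexp ⟪h, x⟫ : ℂ) - (𝐞 (-⟪x, s⟫) : ℂ) * (rexp ⟪0, x⟫ : ℂ) =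
            (𝐞 (-⟪x, s⟫) : ℂ) * ((rexp ⟪h, x⟫ - 1 : ℝ) : ℂ) := by
          simp [mul_sub]
        rw [e, norm_mul, Circle.norm_coe, one_mul, Complex.norm_real, Real.norm_eq_abs,
          le_div_iff₀ two_pos, ← sq_abs, ← sub_nonneg]
        set a := |rexp ⟪h, x⟫ - 1|
        have : η + a ^ 2 / η - a * 2 = (η - a) ^ 2 / η := by field_simp; ring
        rw [this]; positivity
    _ = (η + (∫ x, (rexp ⟪h, x⟫ - 1) ^ 2 ∂μ) / η) / 2 := by
        rw [integral_div, integral_add (integrable_const _) (isq.div_const η), integral_div]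
        simp
    _ ≤ (η + η ^ 2 / η) / 2 := by gcongr
    _ = η := by field_simp; ring

end

variable [FiniteDimensional ℝ V]

/-- If `|Λ(0, s)| = 1` then the character `x ↦ e^{-2πi⟨x, s⟩}` is almost surely constant, hence
`|Λ(0, k s)| = 1` for all `k`, so that `Λ(0, ·)` does not vanish at infinity. -/
theorem norm_fourierLaplace_zero_lt_one
    (hRL : Tendsto (fun s => ‖fourierLaplace μ 0 s‖) (cocompact V) (𝓝 0)) {s : V} (hs : s ≠ 0) :
    ‖fourierLaplace μ 0 s‖ < 1 := by
  have hle : ∀ᵐ x ∂μ, ‖(𝐞 (-⟪x, s⟫) : ℂ)‖ ≤ 1 :=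
    Eventually.of_forall fun x => (Circle.norm_coe _).le
  rcases ae_eq_const_or_norm_integral_lt_of_norm_le_const hle with h | h
  · exfalso
    set c := ⨍ x, (𝐞 (-⟪x, s⟫) : ℂ) ∂μ with hc
    have hc1 : ‖c‖ = 1 := by
      obtain ⟨x, hx⟩ := h.exists
      rw [Function.const_apply] at hx
      rw [← hx]; exact Circle.norm_coe _
    have hk (k : ℕ) : ‖fourierLaplace μ 0 ((k : ℝ) • s)‖ = 1 := by
      have : fourierLaplace μ 0 ((k : ℝ) • s) = c ^ k := by
        rw [fourierLaplace_zero_eq]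
        have e : (fun x => (𝐞 (-⟪x, (k : ℝ) • s⟫) : ℂ)) =ᵐ[μ] fun _ => c ^ k := by
          filter_upwards [h] with x hx
          rw [Function.const_apply] at hx
          rw [← hx, ← Circle.coe_pow, ← AddChar.map_nsmul_eq_pow, inner_smul_right]
          simp
        rw [integral_congr_ae e]
        simp
      rw [this, norm_pow, hc1, one_pow]
    have ht : Tendsto (fun k : ℕ => (k : ℝ) • s) atTop (cocompact V) := by
      rw [← Metric.cobounded_eq_cocompact, ← tendsto_norm_atTop_iff_cobounded]
      simp_rw [norm_smul, Real.norm_natCast]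
      exact tendsto_natCast_atTop_atTop.atTop_mul_const (norm_pos_iff.2 hs)
    have := hRL.comp ht
    simp only [Function.comp_def, hk] at this
    exact one_ne_zero (tendsto_nhds_unique tendsto_const_nhds this)
  · simpa [fourierLaplace_zero_eq] using h

variable [BorelSpace V]

theorem exists_norm_fourierLaplace_zero_le
    (hRL : Tendsto (fun s => ‖fourierLaplace μ 0 s‖) (cocompact V) (𝓝 0)) {r : ℝ} (hr : 0 < r) :
    ∃ δ < 1, ∀ s, r ≤ ‖s‖ → ‖fourierLaplace μ 0 s‖ ≤ δ := by
  have hc : Continuous (fourierLaplace μ 0) := continuous_fourierLaplace (by simp)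
  have hev : ∀ᶠ s in cocompact V, ‖fourierLaplace μ 0 s‖ < 1 / 2 :=
    hRL.eventually_lt_const (by norm_num)
  obtain ⟨K, hK, hKs⟩ := mem_cocompact.1 hev
  have hK' : IsCompact (K ∩ {s | r ≤ ‖s‖}) :=
    hK.inter_right (isClosed_le continuous_const continuous_norm)
  rcases (K ∩ {s | r ≤ ‖s‖}).eq_empty_or_nonempty with h | h
  · refine ⟨1 / 2, by norm_num, fun s hs => (hKs fun hsK => ?_).le⟩
    exact (Set.eq_empty_iff_forall_notMem.1 h) s ⟨hsK, hs⟩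
  · obtain ⟨t, ht, hmax⟩ := hK'.exists_isMaxOn h hc.norm.continuousOn
    have ht0 : t ≠ 0 := norm_pos_iff.1 (hr.trans_le ht.2)
    refine ⟨max (1 / 2) ‖fourierLaplace μ 0 t‖,
      max_lt (by norm_num) (norm_fourierLaplace_zero_lt_one hRL ht0), fun s hs => ?_⟩
    by_cases hsK : s ∈ K
    · exact (hmax ⟨hsK, hs⟩).trans (le_max_right _ _)
    · exact (show ‖fourierLaplace μ 0 s‖ < 1 / 2 from hKs hsK).le.trans (le_max_left _ _)

theorem exists_fourierLaplace_le_of_le_norm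
    (hexp : ∀ h : V, Integrable (fun x => rexp ⟪h, x⟫) μ)
    (hle : ∀ h : V, ∫ x, rexp ⟪h, x⟫ ∂μ ≤ rexp (‖h‖ ^ 2 / 2)) (h2 : MemLp id 2 μ)
    (hmean : ∀ s : V, ∫ x, ⟪x, s⟫ ∂μ = 0)
    (hRL : Tendsto (fun s => ‖fourierLaplace μ 0 s‖) (cocompact V) (𝓝 0)) {r : ℝ} (hr : 0 < r) :
    ∃ δ < 1, ∃ t > 0, ∀ h s : V, ‖h‖ ≤ t → r ≤ ‖s‖ → ‖fourierLaplace μ h s‖ ≤ δ := by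
  obtain ⟨δ, hδ, hs⟩ := exists_norm_fourierLaplace_zero_le hRL hr
  set η := (1 - δ) / 2 with hη
  have hη0 : 0 < η := by rw [hη]; linarith
  obtain ⟨t, ht0, ht⟩ : ∃ t > 0, rexp (2 * t ^ 2) - 1 ≤ η ^ 2 := by
    have c : Continuous fun t : ℝ => rexp (2 * t ^ 2) - 1 := by fun_prop
    have e : ∀ᶠ t in 𝓝[>] (0 : ℝ), rexp (2 * t ^ 2) - 1 < η ^ 2 :=
      nhdsWithin_le_nhds (c.continuousAt.eventually_lt_const (by simpa using pow_pos hη0 2))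
    obtain ⟨t, h1, h0⟩ := (e.and self_mem_nhdsWithin).exists
    exact ⟨t, h0, h1.le⟩
  refine ⟨δ + η, by rw [hη]; linarith, t, ht0, fun h s hh hrs => ?_⟩
  have h1 : rexp (2 * ‖h‖ ^ 2) - 1 ≤ η ^ 2 := le_trans (by gcongr) ht
  have h3 := norm_fourierLaplace_sub_le hexp hle h2 hmean hη0 h1 s
  have h4 := norm_le_norm_add_norm_sub (fourierLaplace μ 0 s) (fourierLaplace μ h s)
  rw [← norm_sub_rev] at h3
  linarith [hs s hrs, norm_sub_rev (fourierLaplace μ 0 s) (fourierLaplace μ h s)]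

end HighFrequencies

/-! ### Integrals of powers of the Fourier–Laplace transform -/

section FourierIntegrals

open Real FourierTransform

open scoped RealInnerProductSpace

variable {V : Type*} [NormedAddCommGroup V] [InnerProductSpace ℝ V] [MeasurableSpace V]
  [BorelSpace V] [FiniteDimensional ℝ V]

theorem lintegral_comp_inv_smul (f : V → ℝ≥0∞) {c : ℝ} (hc : 0 < c) :
    ∫⁻ s, f (c⁻¹ • s) = ENNReal.ofReal (c ^ Module.finrank ℝ V) * ∫⁻ s, f s := by
  have h := lintegral_map_equiv (μ := (volume : Measure V)) f
    (Homeomorph.smulOfNeZero c⁻¹ (inv_ne_zero hc.ne') : V ≃ₜ V).toMeasurableEquiv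
  change ∫⁻ s, f s ∂(volume.map fun s : V => c⁻¹ • s) = ∫⁻ s, f (c⁻¹ • s) at h
  rw [← h, Measure.map_addHaar_smul _ (inv_ne_zero hc.ne'), lintegral_smul_measure, smul_eq_mul,
    inv_pow, inv_inv, abs_of_pos (by positivity)]

/-- For large `n`, uniformly in the tilt `h`, the Fourier transform of the tilted law of the
normalized sum has `L¹` norm at most `(1 + ε) (2π)^{-D/2} e^{|h|²/2}`, `D` being the dimension. The
integrand is bounded by the sum of a Gaussian, which dominates for small `h` and `s`, and of a
remainder that is exponentially small in `n` relative to the integrable power `m`. -/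
theorem eventually_lintegral_fourierLaplace_le {μ : Measure V} [IsProbabilityMeasure μ]
    (hexp : ∀ h : V, Integrable (fun x => rexp ⟪h, x⟫) μ)
    (hle : ∀ h : V, ∫ x, rexp ⟪h, x⟫ ∂μ ≤ rexp (‖h‖ ^ 2 / 2)) (h4 : MemLp id 4 μ)
    (hmean : ∀ s : V, ∫ x, ⟪x, s⟫ ∂μ = 0) (hvar : ∀ s : V, ∫ x, ⟪x, s⟫ ^ 2 ∂μ = ‖s‖ ^ 2)
    (hRL : Tendsto (fun s => ‖fourierLaplace μ 0 s‖) (cocompact V) (𝓝 0))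
    (hsep : ∀ t > 0, ∃ δ < 1, ∀ h : V, t ≤ ‖h‖ →
      rexp (-‖h‖ ^ 2 / 2) * ∫ x, rexp ⟪h, x⟫ ∂μ ≤ δ)
    {m : ℕ} {C : ℝ} (hC0 : 0 ≤ C) (hC : ∀ h : V,
      ∫⁻ s, ENNReal.ofReal ((rexp (-‖h‖ ^ 2 / 2) * ‖fourierLaplace μ h s‖) ^ m) ≤
        ENNReal.ofReal C)
    {ε : ℝ} (hε : 0 < ε) :
    ∀ᶠ n : ℕ in atTop, ∀ h : V,
      ∫⁻ s, ‖fourierLaplace μ ((√n)⁻¹ • h) ((√n)⁻¹ • s)‖ₑ ^ n ≤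
        ENNReal.ofReal ((1 + ε) * ((1 / (2 * π)) ^ (Module.finrank ℝ V / 2 : ℝ)) *
          rexp (‖h‖ ^ 2 / 2)) := by
  set D := Module.finrank ℝ V with hD
  set A : ℝ := (1 / (2 * π)) ^ (D / 2 : ℝ) with hA
  have hA0 : 0 < A := by positivity
  obtain ⟨η, hη0, hη1, hηε⟩ : ∃ η : ℝ, 0 < η ∧ η < 1 ∧
      (1 / (1 - η)) ^ (D / 2 : ℝ) ≤ 1 + ε / 2 := by
    have c : ContinuousAt (fun η : ℝ => (1 / (1 - η)) ^ (D / 2 : ℝ)) 0 := by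
      refine ContinuousAt.rpow_const ?_ (Or.inl (by simp))
      exact continuousAt_const.div (by fun_prop) (by simp)
    have e1 : ∀ᶠ η in 𝓝[>] (0 : ℝ), (1 / (1 - η)) ^ (D / 2 : ℝ) < 1 + ε / 2 :=
      nhdsWithin_le_nhds (c.eventually_lt_const (by simpa using hε))
    have e2 : ∀ᶠ η in 𝓝[>] (0 : ℝ), η < 1 := nhdsWithin_le_nhds (eventually_lt_nhds one_pos)
    obtain ⟨η, h1, h2, h0⟩ := (e1.and (e2.and self_mem_nhdsWithin)).exists
    exact ⟨η, h0, h2, h1.le⟩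
  obtain ⟨r, hr0, hr⟩ := exists_fourierLaplace_le_gaussian hexp hle h4 hmean hvar hη0
  obtain ⟨δ₁, hδ₁, t, ht0, ht⟩ := exists_fourierLaplace_le_of_le_norm hexp hle
    (h4.mono_exponent (by norm_num)) hmean hRL hr0
  obtain ⟨δ₂, hδ₂, hsep'⟩ := hsep (min r t) (lt_min hr0 ht0)
  -- `δ` is kept positive so that `δ ^ (n - m)` can be compared with `δ ^ n`.
  set δ := max (1 / 2) (max δ₁ δ₂) with hδ
  have hδ0 : 0 < δ := lt_of_lt_of_le (by norm_num) (le_max_left _ _)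
  have hδ1 : δ < 1 := max_lt (by norm_num) (max_lt hδ₁ hδ₂)
  set a : V → V → ℝ := fun h s => rexp (-‖h‖ ^ 2 / 2) * ‖fourierLaplace μ h s‖ with ha
  have ha0 (h s : V) : 0 ≤ a h s := by positivity
  set b : ℝ := (1 - η) * (2 * π ^ 2) with hb
  have hb0 : 0 < b := by have := sub_pos.2 hη1; positivity
  have hdich (h s : V) : a h s ≤ rexp (-b * ‖s‖ ^ 2) ∨ a h s ≤ δ := by
    by_cases hh : ‖h‖ ≤ min r t
    · rcases le_or_gt ‖s‖ r with hs | hs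
      · exact Or.inl (hr h s (hh.trans (min_le_left _ _)) hs)
      · refine Or.inr ?_
        calc a h s ≤ 1 * ‖fourierLaplace μ h s‖ := by
              refine mul_le_mul_of_nonneg_right ?_ (norm_nonneg _)
              rw [Real.exp_le_one_iff]
              have := sq_nonneg ‖h‖
              linarith
          _ ≤ δ₁ := by rw [one_mul]; exact ht h s (hh.trans (min_le_right _ _)) hs.le
          _ ≤ δ := (le_max_left _ _).trans (le_max_right _ _)
    · refine Or.inr ?_
      calc a h s ≤ rexp (-‖h‖ ^ 2 / 2) * ∫ x, rexp ⟪h, x⟫ ∂μ := by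
            exact mul_le_mul_of_nonneg_left (norm_fourierLaplace_le _ _ _) (Real.exp_pos _).le
        _ ≤ δ₂ := hsep' h (not_le.1 hh).le
        _ ≤ δ := (le_max_right _ _).trans (le_max_right _ _)
  have hpow (n : ℕ) (hn : m ≤ n) (h s : V) :
      a h s ^ n ≤ rexp (-(n * b) * ‖s‖ ^ 2) + δ ^ (n - m) * a h s ^ m := by
    rcases hdich h s with h1 | h1
    · calc a h s ^ n ≤ rexp (-b * ‖s‖ ^ 2) ^ n := pow_le_pow_left₀ (ha0 h s) h1 n
        _ = rexp (-(n * b) * ‖s‖ ^ 2) := by rw [← Real.exp_nat_mul]; congr 1; ring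
        _ ≤ _ := le_add_of_nonneg_right (mul_nonneg (by positivity) (pow_nonneg (ha0 h s) m))
    · calc a h s ^ n = a h s ^ (n - m) * a h s ^ m := by rw [← pow_add, Nat.sub_add_cancel hn]
        _ ≤ δ ^ (n - m) * a h s ^ m :=
          mul_le_mul_of_nonneg_right (pow_le_pow_left₀ (ha0 h s) h1 _) (pow_nonneg (ha0 h s) m)
        _ ≤ _ := le_add_of_nonneg_left (Real.exp_pos _).le
  have hint (n : ℕ) (hn : m ≤ n) (hn0 : 0 < n) (h : V) :
      ∫⁻ s, ENNReal.ofReal (a h s ^ n) ≤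
        ENNReal.ofReal ((π / (n * b)) ^ (D / 2 : ℝ) + δ ^ (n - m) * C) := by
    have hnb : 0 < n * b := by positivity
    have hg := GaussianFourier.integral_rexp_neg_mul_sq_norm (V := V) hnb
    calc _ ≤ ∫⁻ s : V, ENNReal.ofReal (rexp (-(n * b) * ‖s‖ ^ 2)) +
            ENNReal.ofReal (δ ^ (n - m)) * ENNReal.ofReal (a h s ^ m) := by
          refine lintegral_mono fun s => ?_
          rw [← ENNReal.ofReal_mul (by positivity), ← ENNReal.ofReal_add (by positivity)
            (mul_nonneg (by positivity) (pow_nonneg (ha0 h s) m))]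
          exact ENNReal.ofReal_le_ofReal (hpow n hn h s)
      _ = ENNReal.ofReal ((π / (n * b)) ^ (D / 2 : ℝ)) + ENNReal.ofReal (δ ^ (n - m)) *
            ∫⁻ s, ENNReal.ofReal (a h s ^ m) := by
          rw [lintegral_add_left (by fun_prop), lintegral_const_mul' _ _ ENNReal.ofReal_ne_top,
            ← ofReal_integral_eq_lintegral_ofReal _ (Eventually.of_forall fun s => by positivity),
            hg]
          by_contra hi
          rw [integral_undef hi] at hg
          have : 0 < (π / (n * b)) ^ (Module.finrank ℝ V / 2 : ℝ) := by positivity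
          exact this.ne hg
      _ ≤ ENNReal.ofReal ((π / (n * b)) ^ (D / 2 : ℝ)) + ENNReal.ofReal (δ ^ (n - m)) *
            ENNReal.ofReal C := by gcongr; exact hC h
      _ = _ := by
          rw [← ENNReal.ofReal_mul (by positivity), ← ENNReal.ofReal_add (by positivity)
            (by positivity)]
  have hsmall : ∀ᶠ n : ℕ in atTop, (n : ℝ) ^ D * δ ^ n < ε / 2 * A * δ ^ m / (C + 1) :=
    (tendsto_pow_const_mul_const_pow_of_lt_one D hδ0.le hδ1).eventually_lt_const (by positivity)
  filter_upwards [hsmall, eventually_ge_atTop m, eventually_gt_atTop 0] with n hns hnm hn0 h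
  have hnR : (1 : ℝ) ≤ n := by exact_mod_cast hn0
  have hsn : 0 < √(n : ℝ) := by positivity
  have hmain : √(n : ℝ) ^ D * ((π / (n * b)) ^ (D / 2 : ℝ) + δ ^ (n - m) * C) ≤ (1 + ε) * A := by
    have e1 : √(n : ℝ) ^ D * (π / (n * b)) ^ (D / 2 : ℝ) = A * (1 / (1 - η)) ^ (D / 2 : ℝ) := by
      have : √(n : ℝ) ^ D = (n : ℝ) ^ (D / 2 : ℝ) := by
        rw [Real.sqrt_eq_rpow, ← Real.rpow_natCast, ← Real.rpow_mul (by positivity)]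
        congr 1; ring
      rw [this, hA, ← Real.mul_rpow (by positivity) (by positivity),
        ← Real.mul_rpow (by positivity) (by have := sub_pos.2 hη1; positivity)]
      congr 1
      have := (sub_pos.2 hη1).ne'
      rw [hb]
      field_simp
    have e2 : √(n : ℝ) ^ D * (δ ^ (n - m) * C) ≤ ε / 2 * A := by
      have h1 : δ ^ (n - m) = δ ^ n / δ ^ m := by
        rw [eq_div_iff (by positivity), ← pow_add, Nat.sub_add_cancel hnm]
      have h2 : √(n : ℝ) ≤ n := Real.sqrt_le_iff.2 ⟨by positivity, by nlinarith⟩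
      have h3 : (n : ℝ) ^ D * δ ^ n * (C + 1) ≤ ε / 2 * A * δ ^ m :=
        ((lt_div_iff₀ (by positivity)).1 hns).le
      calc √(n : ℝ) ^ D * (δ ^ (n - m) * C) ≤ (n : ℝ) ^ D * (δ ^ n / δ ^ m * (C + 1)) := by
            rw [h1]; gcongr; linarith
        _ = (n : ℝ) ^ D * δ ^ n * (C + 1) / δ ^ m := by ring
        _ ≤ _ := by rw [div_le_iff₀ (by positivity)]; exact h3
    rw [mul_add, e1]
    have := mul_le_mul_of_nonneg_left hηε hA0.le
    linarith
  have hscale (s : V) : ‖fourierLaplace μ ((√n)⁻¹ • h) ((√n)⁻¹ • s)‖ₑ ^ n =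
      ENNReal.ofReal (rexp (‖h‖ ^ 2 / 2)) *
        ENNReal.ofReal (a ((√n)⁻¹ • h) ((√n)⁻¹ • s) ^ n) := by
    rw [← ENNReal.ofReal_mul (by positivity), ← ofReal_norm, ← ENNReal.ofReal_pow (norm_nonneg _)]
    congr 1
    simp only [ha]
    rw [mul_pow, ← Real.exp_nat_mul, ← mul_assoc, ← Real.exp_add, norm_smul, norm_inv,
      Real.norm_of_nonneg hsn.le, mul_pow, inv_pow, Real.sq_sqrt (by positivity)]
    have : ‖h‖ ^ 2 / 2 + n * (-((n : ℝ)⁻¹ * ‖h‖ ^ 2) / 2) = 0 := by field_simp; ring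
    rw [this, Real.exp_zero, one_mul]
  simp_rw [hscale]
  rw [lintegral_const_mul' _ _ ENNReal.ofReal_ne_top,
    lintegral_comp_inv_smul (fun s => ENNReal.ofReal (a ((√n)⁻¹ • h) s ^ n)) hsn]
  calc _ ≤ ENNReal.ofReal (rexp (‖h‖ ^ 2 / 2)) * (ENNReal.ofReal (√n ^ D) *
        ENNReal.ofReal ((π / (n * b)) ^ (D / 2 : ℝ) + δ ^ (n - m) * C)) := by
        gcongr; exact hint n hnm hn0 _
    _ = ENNReal.ofReal (rexp (‖h‖ ^ 2 / 2) *
        (√n ^ D * ((π / (n * b)) ^ (D / 2 : ℝ) + δ ^ (n - m) * C))) := by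
        rw [← ENNReal.ofReal_mul (by positivity), ← ENNReal.ofReal_mul (by positivity)]
    _ ≤ _ := by
        refine ENNReal.ofReal_le_ofReal ?_
        rw [mul_comm]
        gcongr

end FourierIntegrals

/-! ### The functional `T_∞` relative to the standard normal density -/

section NormalDensity

open Real

open scoped RealInnerProductSpace

variable {d : ℕ}

theorem stdNormalDensity_pos (x : EuclideanSpace ℝ (Fin d)) : 0 < stdNormalDensity d x := by
  unfold stdNormalDensity; positivity

theorem continuous_stdNormalDensity : Continuous (stdNormalDensity d) := by
  unfold stdNormalDensity; fun_prop

theorem lintegral_stdNormalDensity :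
    ∫⁻ x, ENNReal.ofReal (stdNormalDensity d x) = 1 := by
  have h : ∫ x, stdNormalDensity d x = 1 := by
    have e (x : EuclideanSpace ℝ (Fin d)) : stdNormalDensity d x =
        1 / (2 * π) ^ ((d : ℝ) / 2) * rexp (-(1 / 2) * ‖x‖ ^ 2) := by
      unfold stdNormalDensity; congr 2; ring
    simp_rw [e]
    rw [integral_const_mul, GaussianFourier.integral_rexp_neg_mul_sq_norm (by norm_num),
      finrank_euclideanSpace_fin]
    have : π / (1 / 2) = 2 * π := by ring
    rw [this]
    exact one_div_mul_cancel (by positivity)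
  rw [← ofReal_integral_eq_lintegral_ofReal _
    (Eventually.of_forall fun x => (stdNormalDensity_pos x).le), h, ENNReal.ofReal_one]
  by_contra hi
  rw [integral_undef hi] at h
  exact zero_ne_one h

variable {Ω : Type*} [MeasurableSpace Ω] {P : Measure Ω} {Z : Ω → EuclideanSpace ℝ (Fin d)}

theorem tsallisInf_densityOf_le {ε : ℝ} (hε : 0 ≤ ε)
    (hp : ∀ᵐ x, pdf Z P volume x ≤ ENNReal.ofReal ((1 + ε) * stdNormalDensity d x)) :
    tsallisInf (densityOf Z P) (stdNormalDensity d) ≤ ε := by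
  refine essSup_le_of_ae_le _ ?_
  filter_upwards [hp] with x hx
  have hφ := stdNormalDensity_pos x
  rw [EReal.coe_le_coe_iff, div_le_iff₀ hφ]
  have := ENNReal.toReal_le_of_le_ofReal (by positivity) hx
  unfold densityOf
  linarith

variable [IsProbabilityMeasure P]

theorem ofReal_toReal_pdf_ae_eq :
    (fun x => ENNReal.ofReal (pdf Z P volume x).toReal) =ᵐ[volume] pdf Z P volume :=
  pdf.ofReal_toReal_ae_eq

/-- If `(p - φ) / φ` were essentially negative, the integral of `p` would be less than that of
`φ`. -/
theorem tsallisInf_densityOf_nonneg [HasPDF Z P volume] :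
    0 ≤ tsallisInf (densityOf Z P) (stdNormalDensity d) := by
  by_contra hneg
  have hae := ae_lt_of_essSup_lt (not_le.1 hneg)
  have hlt : ∀ᵐ x, pdf Z P volume x < ENNReal.ofReal (stdNormalDensity d x) := by
    filter_upwards [hae, ofReal_toReal_pdf_ae_eq (P := P) (Z := Z)] with x hx hp
    rw [EReal.coe_neg', div_neg_iff] at hx
    have hφ := stdNormalDensity_pos x
    have hx' : densityOf Z P x < stdNormalDensity d x := by
      rcases hx with h | h <;> linarith
    rw [← hp]
    exact (ENNReal.ofReal_lt_ofReal_iff hφ).2 hx'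
  have hone : ∫⁻ x, pdf Z P volume x = 1 := by
    rw [pdf.lintegral_eq_measure_univ, measure_univ]
  have := lintegral_strict_mono (NeZero.ne (volume : Measure (EuclideanSpace ℝ (Fin d))))
    (continuous_stdNormalDensity.measurable.ennreal_ofReal.aemeasurable) (by simp [hone]) hlt
  rw [hone, lintegral_stdNormalDensity] at this
  exact lt_irrefl _ this

theorem exists_pdf_le_of_tsallisInf_lt_top
    (h : tsallisInf (densityOf Z P) (stdNormalDensity d) < ⊤) :
    ∃ K : ℝ, 0 ≤ K ∧
      ∀ᵐ x, pdf Z P volume x ≤ ENNReal.ofReal (K * stdNormalDensity d x) := by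
  obtain ⟨c, hc, -⟩ := EReal.lt_iff_exists_real_btwn.1 h
  refine ⟨max 0 (1 + c), le_max_left _ _, ?_⟩
  filter_upwards [ae_lt_of_essSup_lt hc, ofReal_toReal_pdf_ae_eq (P := P) (Z := Z)]
    with x hx hp
  have hφ := stdNormalDensity_pos x
  rw [EReal.coe_lt_coe_iff, div_lt_iff₀ hφ] at hx
  rw [← hp]
  refine ENNReal.ofReal_le_ofReal ?_
  change densityOf Z P x ≤ _
  have := mul_le_mul_of_nonneg_right (le_max_right 0 (1 + c)) hφ.le
  linarith

end NormalDensity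

/-! ### Consequences of the separation property and of the moment assumptions -/

section LaplaceTransform

open Real

open scoped RealInnerProductSpace

variable {d : ℕ} {Ω₀ : Type*} [MeasurableSpace Ω₀] {P₀ : Measure Ω₀}
  {X : Ω₀ → EuclideanSpace ℝ (Fin d)}

theorem laplaceTransform_eq_lintegral_map (hX : AEMeasurable X P₀)
    (t : EuclideanSpace ℝ (Fin d)) :
    laplaceTransform X P₀ t = ∫⁻ x, ENNReal.ofReal (rexp ⟪t, x⟫) ∂(P₀.map X) := by
  rw [lintegral_map' (by fun_prop) hX]
  rfl

variable [IsProbabilityMeasure P₀]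

theorem HasSeparationProperty.integrable_exp (hsep : HasSeparationProperty X P₀)
    (hX : AEMeasurable X P₀) (t : EuclideanSpace ℝ (Fin d)) :
    Integrable (fun x => rexp ⟪t, x⟫) (P₀.map X) := by
  have := Measure.isProbabilityMeasure_map hX
  rcases eq_or_ne t 0 with rfl | ht
  · simp
  refine ⟨by fun_prop, ?_⟩
  rw [hasFiniteIntegral_iff_ofReal (Eventually.of_forall fun x => (Real.exp_pos _).le),
    ← laplaceTransform_eq_lintegral_map hX]
  have h := (le_iSup₂ (f := fun (s : EuclideanSpace ℝ (Fin d)) (_ : ‖t‖ ≤ ‖s‖) =>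
    ENNReal.ofReal (rexp (-‖s‖ ^ 2 / 2)) * laplaceTransform X P₀ s) t le_rfl).trans_lt
    (hsep ‖t‖ (norm_pos_iff.2 ht))
  by_contra htop
  rw [not_lt_top_iff.1 htop, ENNReal.mul_top (by simp [Real.exp_pos])] at h
  exact not_top_lt h

theorem HasSeparationProperty.exists_le (hsep : HasSeparationProperty X P₀)
    (hX : AEMeasurable X P₀) {t₀ : ℝ} (ht₀ : 0 < t₀) :
    ∃ δ < 1, ∀ t : EuclideanSpace ℝ (Fin d), t₀ ≤ ‖t‖ →
      rexp (-‖t‖ ^ 2 / 2) * ∫ x, rexp ⟪t, x⟫ ∂(P₀.map X) ≤ δ := by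
  set S := ⨆ (t : EuclideanSpace ℝ (Fin d)) (_ : t₀ ≤ ‖t‖),
    ENNReal.ofReal (rexp (-‖t‖ ^ 2 / 2)) * laplaceTransform X P₀ t with hS
  have hS1 : S < 1 := hsep t₀ ht₀
  refine ⟨S.toReal, ?_, fun t ht => ?_⟩
  · simpa using (ENNReal.toReal_lt_toReal hS1.ne_top ENNReal.one_ne_top).2 hS1
  · rw [← ENNReal.ofReal_le_iff_le_toReal hS1.ne_top, ENNReal.ofReal_mul (Real.exp_pos _).le,
      ofReal_integral_eq_lintegral_ofReal (hsep.integrable_exp hX t)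
        (Eventually.of_forall fun x => (Real.exp_pos _).le),
      ← laplaceTransform_eq_lintegral_map hX]
    exact le_iSup₂ (f := fun (s : EuclideanSpace ℝ (Fin d)) (_ : t₀ ≤ ‖s‖) =>
      ENNReal.ofReal (rexp (-‖s‖ ^ 2 / 2)) * laplaceTransform X P₀ s) t ht

theorem HasSeparationProperty.integral_exp_le (hsep : HasSeparationProperty X P₀)
    (hX : AEMeasurable X P₀) (t : EuclideanSpace ℝ (Fin d)) :
    ∫ x, rexp ⟪t, x⟫ ∂(P₀.map X) ≤ rexp (‖t‖ ^ 2 / 2) := by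
  have := Measure.isProbabilityMeasure_map hX
  rcases eq_or_ne t 0 with rfl | ht
  · simp
  obtain ⟨δ, hδ, h⟩ := hsep.exists_le hX (norm_pos_iff.2 ht)
  have h1 := (h t le_rfl).trans hδ.le
  rw [neg_div, Real.exp_neg, inv_mul_le_iff₀ (Real.exp_pos _), mul_one] at h1
  exact h1

theorem memLp_of_integrable_exp {μ : Measure (EuclideanSpace ℝ (Fin d))}
    (hexp : ∀ h : EuclideanSpace ℝ (Fin d), Integrable (fun x => rexp ⟪h, x⟫) μ) :
    MemLp id 4 μ := by
  refine MemLp.of_eval_piLp fun i => ?_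
  have hi (c : ℝ) : Integrable (fun x : EuclideanSpace ℝ (Fin d) => rexp (c * x i)) μ := by
    refine (hexp (c • EuclideanSpace.single i 1)).congr (Eventually.of_forall fun x => ?_)
    simp [real_inner_smul_left, EuclideanSpace.inner_single_left]
  have h := integrable_pow_abs_of_integrable_exp_mul (X := fun x : EuclideanSpace ℝ (Fin d) => x i)
    (t := 1) one_ne_zero (hi 1) (hi (-1)) 4
  have hm : AEStronglyMeasurable (fun x : EuclideanSpace ℝ (Fin d) => x i) μ := by fun_prop
  refine (integrable_norm_rpow_iff hm (by norm_num) (by norm_num)).1 ?_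
  refine h.congr (Eventually.of_forall fun x => ?_)
  simp only [Real.norm_eq_abs, ENNReal.toReal_ofNat]
  norm_cast

theorem integral_inner_map_eq_zero (hX : AEMeasurable X P₀) (hmean : ∫ ω, X ω ∂P₀ = 0)
    (h2 : MemLp id 2 (P₀.map X)) (s : EuclideanSpace ℝ (Fin d)) :
    ∫ x, ⟪x, s⟫ ∂(P₀.map X) = 0 := by
  have := Measure.isProbabilityMeasure_map hX
  have hi : Integrable id (P₀.map X) := h2.integrable (by norm_num)
  simp_rw [real_inner_comm s]
  have h := integral_inner (𝕜 := ℝ) hi s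
  simp only [id] at h
  rw [h]
  have hm := integral_map hX (f := fun x => x) (by fun_prop)
  rw [hm, hmean, inner_zero_right]

theorem integral_sq_inner_map (hX : AEMeasurable X P₀) (hmean : ∫ ω, X ω ∂P₀ = 0)
    (hcov : ∀ i j : Fin d,
      covariance (fun ω => X ω i) (fun ω => X ω j) P₀ = if i = j then 1 else 0)
    (h2 : MemLp id 2 (P₀.map X)) (s : EuclideanSpace ℝ (Fin d)) :
    ∫ x, ⟪x, s⟫ ^ 2 ∂(P₀.map X) = ‖s‖ ^ 2 := by
  have hX2 : MemLp X 2 P₀ := by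
    have := (memLp_map_measure_iff (by fun_prop) hX).1 h2
    simpa using this
  have hXi (i : Fin d) : MemLp (fun ω => X ω i) 2 P₀ := hX2.eval_piLp i
  have hmi (i : Fin d) : ∫ ω, X ω i ∂P₀ = 0 := by
    have h := integral_inner_map_eq_zero hX hmean h2 (EuclideanSpace.single i 1)
    rw [integral_map hX (by fun_prop)] at h
    simpa [EuclideanSpace.inner_single_right] using h
  have hij (i j : Fin d) : ∫ ω, X ω i * X ω j ∂P₀ = if i = j then 1 else 0 := by
    rw [← hcov, covariance_eq_sub (hXi i) (hXi j), hmi i]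
    simp
  have hint (i j : Fin d) : Integrable (fun ω => s i * s j * (X ω i * X ω j)) P₀ :=
    ((hXi i).integrable_mul (hXi j)).const_mul _
  rw [integral_map hX (by fun_prop)]
  have e (ω : Ω₀) : ⟪X ω, s⟫ ^ 2 = ∑ i, ∑ j, s i * s j * (X ω i * X ω j) := by
    rw [PiLp.inner_apply, sq, Finset.sum_mul_sum]
    refine Finset.sum_congr rfl fun i _ => Finset.sum_congr rfl fun j _ => ?_
    simp only [RCLike.inner_apply, conj_trivial]
    ring
  simp_rw [e]
  rw [integral_finsetSum _ fun i _ => integrable_finsetSum _ fun j _ => hint i j]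
  simp_rw [integral_finsetSum _ fun j _ => hint _ j, integral_const_mul, hij]
  rw [EuclideanSpace.real_norm_sq_eq]
  simp [sq]

end LaplaceTransform

/-! ### Normalized sums -/

section NormalizedSums

open Real FourierTransform

open scoped RealInnerProductSpace

variable {d : ℕ} {Ω : Type*} [MeasurableSpace Ω] {P : Measure Ω}
  {Xs : ℕ → Ω → EuclideanSpace ℝ (Fin d)} {μ : Measure (EuclideanSpace ℝ (Fin d))}

theorem aemeasurable_normalizedSum (hXs : ∀ k, AEMeasurable (Xs k) P) (n : ℕ) :
    AEMeasurable (normalizedSum Xs n) P := by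
  exact (Finset.aemeasurable_fun_sum (Finset.range n) fun k _ => hXs k).const_smul (√(n : ℝ))⁻¹

theorem fourierLaplace_normalizedSum (hXs : ∀ k, AEMeasurable (Xs k) P)
    (hindep : iIndepFun Xs P) (hlaw : ∀ k, P.map (Xs k) = μ) (n : ℕ)
    (h s : EuclideanSpace ℝ (Fin d)) :
    fourierLaplace (P.map (normalizedSum Xs n)) h s =
      fourierLaplace μ ((√n)⁻¹ • h) ((√n)⁻¹ • s) ^ n := by
  set c := (√(n : ℝ))⁻¹ with hc
  have hcont (h s : EuclideanSpace ℝ (Fin d)) :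
      Continuous fun x => (𝐞 (-⟪x, s⟫) : ℂ) * (rexp ⟪h, x⟫ : ℂ) := by fun_prop
  have e (ω : Ω) : (𝐞 (-⟪normalizedSum Xs n ω, s⟫) : ℂ) * (rexp ⟪h, normalizedSum Xs n ω⟫ : ℂ) =
      ∏ k : Fin n, (𝐞 (-⟪Xs k ω, c • s⟫) : ℂ) * (rexp ⟪c • h, Xs k ω⟫ : ℂ) := by
    rw [Finset.prod_mul_distrib, ← Complex.ofReal_prod, ← Real.exp_sum]
    congr 1
    · simp only [Real.fourierChar_apply]
      rw [← Complex.exp_sum]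
      congr 1
      rw [← Finset.sum_mul, ← Complex.ofReal_sum, ← Finset.mul_sum, Finset.sum_neg_distrib]
      congr 4
      simp only [normalizedSum, real_inner_smul_left, real_inner_smul_right, sum_inner,
        Finset.mul_sum]
      rw [Finset.sum_range]
    · congr 2
      simp only [normalizedSum, real_inner_smul_left, real_inner_smul_right, inner_sum,
        Finset.mul_sum]
      rw [Finset.sum_range]
  rw [fourierLaplace_eq, integral_map (aemeasurable_normalizedSum hXs n)
    (hcont h s).aestronglyMeasurable]
  simp_rw [e]
  rw [(hindep.precomp Fin.val_injective).integral_fun_prod_comp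
    (f := fun _ x => (𝐞 (-⟪x, c • s⟫) : ℂ) * (rexp ⟪c • h, x⟫ : ℂ))
    (fun k => hXs k) fun _ => (hcont _ _).aestronglyMeasurable]
  have (k : Fin n) : ∫ ω, (𝐞 (-⟪Xs k ω, c • s⟫) : ℂ) * (rexp ⟪c • h, Xs k ω⟫ : ℂ) ∂P =
      fourierLaplace μ (c • h) (c • s) := by
    rw [fourierLaplace_eq, ← hlaw k, integral_map (hXs k) (hcont _ _).aestronglyMeasurable]
  rw [Finset.prod_congr rfl fun k _ => this k, Finset.prod_const, Finset.card_univ,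
    Fintype.card_fin]

theorem fourierLaplace_apply_zero (ν : Measure (EuclideanSpace ℝ (Fin d)))
    (h : EuclideanSpace ℝ (Fin d)) :
    fourierLaplace ν h 0 = ((∫ x, rexp ⟪h, x⟫ ∂ν : ℝ) : ℂ) := by
  rw [fourierLaplace_eq, ← integral_complex_ofReal]
  simp

variable [IsProbabilityMeasure P]

theorem integrable_exp_normalizedSum (hXs : ∀ k, AEMeasurable (Xs k) P)
    (hindep : iIndepFun Xs P) (hlaw : ∀ k, P.map (Xs k) = μ)
    (hexp : ∀ h, Integrable (fun x => rexp ⟪h, x⟫) μ)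
    (hle : ∀ h, ∫ x, rexp ⟪h, x⟫ ∂μ ≤ rexp (‖h‖ ^ 2 / 2))
    {n : ℕ} (hn : 0 < n) (h : EuclideanSpace ℝ (Fin d)) :
    Integrable (fun x => rexp ⟪h, x⟫) (P.map (normalizedSum Xs n)) ∧
      ∫ x, rexp ⟪h, x⟫ ∂(P.map (normalizedSum Xs n)) ≤ rexp (‖h‖ ^ 2 / 2) := by
  have : IsProbabilityMeasure μ := hlaw 0 ▸ Measure.isProbabilityMeasure_map (hXs 0)
  have hL : ∫ x, rexp ⟪h, x⟫ ∂(P.map (normalizedSum Xs n)) =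
      (∫ x, rexp ⟪(√(n : ℝ))⁻¹ • h, x⟫ ∂μ) ^ n := by
    have := fourierLaplace_normalizedSum hXs hindep hlaw n h 0
    rw [smul_zero, fourierLaplace_apply_zero, fourierLaplace_apply_zero] at this
    exact_mod_cast this
  have hpos : 0 < ∫ x, rexp ⟪(√(n : ℝ))⁻¹ • h, x⟫ ∂μ := integral_exp_pos (hexp _)
  refine ⟨?_, ?_⟩
  · -- The Bochner integral of a nonintegrable function would be `0`.
    by_contra hi
    rw [integral_undef hi] at hL
    exact (pow_pos hpos n).ne hL
  · rw [hL]
    have hnR : (0 : ℝ) < n := by exact_mod_cast hn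
    calc _ ≤ rexp (‖(√(n : ℝ))⁻¹ • h‖ ^ 2 / 2) ^ n := pow_le_pow_left₀ hpos.le (hle _) n
      _ = rexp (‖h‖ ^ 2 / 2) := by
        rw [← Real.exp_nat_mul, norm_smul, norm_inv, Real.norm_of_nonneg (Real.sqrt_nonneg _),
          mul_pow, inv_pow, Real.sq_sqrt hnR.le]
        congr 1
        field_simp

/-- Riemann–Lebesgue for `X` itself, inherited from the density of a normalized sum. -/
theorem tendsto_norm_fourierLaplace_zero (hXs : ∀ k, AEMeasurable (Xs k) P)
    (hindep : iIndepFun Xs P) (hlaw : ∀ k, P.map (Xs k) = μ) {m : ℕ} (hm : 0 < m)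
    [HasPDF (normalizedSum Xs m) P volume] :
    Tendsto (fun s => ‖fourierLaplace μ 0 s‖) (cocompact _) (𝓝 0) := by
  have hsm : √(m : ℝ) ≠ 0 := by positivity
  have hRL : Tendsto (fourierLaplace (P.map (normalizedSum Xs m)) 0) (cocompact _) (𝓝 0) := by
    have h := tendsto_integral_exp_inner_smul_cocompact
      (fun x => ((pdf (normalizedSum Xs m) P volume x).toReal : ℂ))
    refine h.congr fun s => ?_
    rw [fourierLaplace_zero_eq, map_eq_withDensity_pdf (normalizedSum Xs m) P volume,
      integral_withDensity_eq_integral_toReal_smul (measurable_pdf _ _ _) pdf.ae_lt_top]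
    refine integral_congr_ae (Eventually.of_forall fun x => ?_)
    simp [Circle.smul_def, mul_comm]
  have hsmul : Tendsto (fun s : EuclideanSpace ℝ (Fin d) => √(m : ℝ) • s) (cocompact _)
      (cocompact _) := (Homeomorph.smulOfNeZero _ hsm).isClosedEmbedding.tendsto_cocompact
  have h := (hRL.comp hsmul).norm.rpow_const (p := (m : ℝ)⁻¹) (Or.inr (by positivity))
  have hz : (m : ℝ)⁻¹ ≠ 0 := by positivity
  rw [norm_zero, Real.zero_rpow hz] at h
  refine h.congr fun s => ?_
  simp only [Function.comp_apply]
  rw [fourierLaplace_normalizedSum hXs hindep hlaw, smul_zero, inv_smul_smul₀ hsm, norm_pow,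
    Real.pow_rpow_inv_natCast (norm_nonneg _) hm.ne']

/-- A bound `p ≤ K φ` for the density of a normalized sum survives tilting, and gives a bound on
the `L²`-norm of its Fourier–Laplace transform which, after normalization by `e^{-|h|²/2}`, is
uniform in the tilt `h`. -/
theorem lintegral_fourierLaplace_pow_le (hXs : ∀ k, AEMeasurable (Xs k) P)
    (hindep : iIndepFun Xs P) (hlaw : ∀ k, P.map (Xs k) = μ)
    (hexp : ∀ h, Integrable (fun x => rexp ⟪h, x⟫) μ)
    (hle : ∀ h, ∫ x, rexp ⟪h, x⟫ ∂μ ≤ rexp (‖h‖ ^ 2 / 2)) {m : ℕ} (hm : 0 < m)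
    [HasPDF (normalizedSum Xs m) P volume] {K : ℝ} (hK : 0 ≤ K)
    (hp : ∀ᵐ x, pdf (normalizedSum Xs m) P volume x ≤
      ENNReal.ofReal (K * stdNormalDensity d x)) (h : EuclideanSpace ℝ (Fin d)) :
    ∫⁻ s, ENNReal.ofReal ((rexp (-‖h‖ ^ 2 / 2) * ‖fourierLaplace μ h s‖) ^ (2 * m)) ≤
      ENNReal.ofReal (K / (2 * π) ^ ((d : ℝ) / 2)) := by
  set Z := normalizedSum Xs m with hZ
  set B := K / (2 * π) ^ ((d : ℝ) / 2) with hB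
  have hB0 : 0 ≤ B := by positivity
  have hmR : (1 : ℝ) ≤ m := by exact_mod_cast hm
  have hsm : 0 < √(m : ℝ) := by positivity
  set k := √(m : ℝ) • h with hk
  have hk2 : ‖k‖ ^ 2 = m * ‖h‖ ^ 2 := by
    rw [hk, norm_smul, Real.norm_of_nonneg hsm.le, mul_pow, Real.sq_sqrt (by positivity)]
  obtain ⟨hei, hel⟩ := integrable_exp_normalizedSum hXs hindep hlaw hexp hle hm k
  set ν := (P.map Z).withDensity fun x => ENNReal.ofReal (rexp ⟪k, x⟫) with hν
  have hmass : ν Set.univ ≤ ENNReal.ofReal (rexp (‖k‖ ^ 2 / 2)) := by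
    rw [hν, withDensity_apply _ MeasurableSet.univ, Measure.restrict_univ,
      ← ofReal_integral_eq_lintegral_ofReal hei (Eventually.of_forall fun x => (exp_pos _).le)]
    exact ENNReal.ofReal_le_ofReal hel
  have : IsFiniteMeasure ν := ⟨hmass.trans_lt ENNReal.ofReal_lt_top⟩
  have hden : ν ≤ ENNReal.ofReal (B * rexp (‖k‖ ^ 2 / 2)) • volume := by
    rw [hν, map_eq_withDensity_pdf Z P volume,
      ← withDensity_mul _ (measurable_pdf _ _ _) (by fun_prop), ← withDensity_const]
    refine withDensity_mono ?_
    filter_upwards [hp] with x hx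
    rw [Pi.mul_apply]
    calc _ ≤ ENNReal.ofReal (K * stdNormalDensity d x) * ENNReal.ofReal (rexp ⟪k, x⟫) := by
          gcongr
      _ = ENNReal.ofReal (B * (rexp (-‖x‖ ^ 2 / 2) * rexp ⟪k, x⟫)) := by
          rw [← ENNReal.ofReal_mul (mul_nonneg hK (stdNormalDensity_pos x).le)]
          congr 1
          simp only [stdNormalDensity, hB]
          ring
      _ ≤ _ := by
          refine ENNReal.ofReal_le_ofReal (mul_le_mul_of_nonneg_left ?_ hB0)
          rw [← Real.exp_add, Real.exp_le_exp]
          have := norm_sub_sq_real k x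
          nlinarith [sq_nonneg ‖k - x‖]
  have hL2 := (lintegral_sq_fourierLaplace_le ν _ hden).trans (mul_le_mul_right hmass _)
  have hF (s : EuclideanSpace ℝ (Fin d)) : ‖fourierLaplace ν 0 s‖ₑ ^ 2 =
      ‖fourierLaplace μ h ((√(m : ℝ))⁻¹ • s)‖ₑ ^ (2 * m) := by
    rw [hν, fourierLaplace_withDensity, fourierLaplace_normalizedSum hXs hindep hlaw, hk,
      inv_smul_smul₀ hsm.ne', enorm_pow, ← pow_mul, mul_comm]
  simp_rw [hF] at hL2
  rw [lintegral_comp_inv_smul (fun s => ‖fourierLaplace μ h s‖ₑ ^ (2 * m)) hsm,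
    ← ENNReal.ofReal_mul (by positivity)] at hL2
  have hone : 1 ≤ ENNReal.ofReal (√(m : ℝ) ^ Module.finrank ℝ (EuclideanSpace ℝ (Fin d))) := by
    rw [ENNReal.one_le_ofReal]
    exact one_le_pow₀ (Real.one_le_sqrt.2 hmR)
  have hscale (s : EuclideanSpace ℝ (Fin d)) :
      ENNReal.ofReal ((rexp (-‖h‖ ^ 2 / 2) * ‖fourierLaplace μ h s‖) ^ (2 * m)) =
        ENNReal.ofReal (rexp (-(m * ‖h‖ ^ 2))) * ‖fourierLaplace μ h s‖ₑ ^ (2 * m) := by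
    rw [mul_pow, ENNReal.ofReal_mul (by positivity), ENNReal.ofReal_pow (norm_nonneg _),
      ofReal_norm, ← Real.exp_nat_mul]
    congr 3
    push_cast; ring
  simp_rw [hscale]
  rw [lintegral_const_mul' _ _ ENNReal.ofReal_ne_top]
  calc _ ≤ ENNReal.ofReal (rexp (-(m * ‖h‖ ^ 2))) *
        ENNReal.ofReal (B * rexp (‖k‖ ^ 2 / 2) * rexp (‖k‖ ^ 2 / 2)) := by
        gcongr
        exact (le_mul_of_one_le_left zero_le hone).trans hL2
    _ = ENNReal.ofReal B := by
        rw [← ENNReal.ofReal_mul (by positivity)]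
        congr 1
        calc _ = B * (rexp (-(m * ‖h‖ ^ 2)) * (rexp (‖k‖ ^ 2 / 2) * rexp (‖k‖ ^ 2 / 2))) := by ring
          _ = B := by rw [← Real.exp_add, ← Real.exp_add, hk2]; ring_nf; simp

end NormalizedSums

/-! ### From Fourier integrals to a pointwise bound by a multiple of `φ` -/

section DensityBound

open Real

open scoped RealInnerProductSpace

variable {d : ℕ} {Ω : Type*} [MeasurableSpace Ω] {P : Measure Ω} [IsProbabilityMeasure P]
  {Z : Ω → EuclideanSpace ℝ (Fin d)}

/-- If `e^{⟨h, z⟩} p(z) ≤ c (2π)^{-d/2} e^{|h|²/2}` for all tilts `h`, in the sense of Fourier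
integrals, then `p ≤ c φ`: take `h = z`. The exceptional null sets depend on `h`, so this is done
along a countable dense set of tilts. -/
theorem hasPDF_and_pdf_le_of_lintegral_fourierLaplace_le (hZ : AEMeasurable Z P)
    (hexp : ∀ h, Integrable (fun x => rexp ⟪h, x⟫) (P.map Z)) {c : ℝ} (hc : 0 ≤ c)
    (hF : ∀ h, ∫⁻ s, ‖fourierLaplace (P.map Z) h s‖ₑ ≤
      ENNReal.ofReal (c * (1 / (2 * π)) ^ ((d : ℝ) / 2) * rexp (‖h‖ ^ 2 / 2))) :
    HasPDF Z P volume ∧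
      ∀ᵐ x, pdf Z P volume x ≤ ENNReal.ofReal (c * stdNormalDensity d x) := by
  set B : ℝ := c * (1 / (2 * π)) ^ ((d : ℝ) / 2) with hB
  have hB0 : 0 ≤ B := by positivity
  have := Measure.isProbabilityMeasure_map hZ
  have htilt (h : EuclideanSpace ℝ (Fin d)) :
      (P.map Z).withDensity (fun x => ENNReal.ofReal (rexp ⟪h, x⟫)) ≤
        ENNReal.ofReal (B * rexp (‖h‖ ^ 2 / 2)) • volume := by
    set ν := (P.map Z).withDensity fun x => ENNReal.ofReal (rexp ⟪h, x⟫) with hν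
    have : IsFiniteMeasure ν := isFiniteMeasure_withDensity_ofReal (hexp h).2
    have hFh : ∫⁻ s, ‖fourierLaplace ν 0 s‖ₑ ≤ ENNReal.ofReal (B * rexp (‖h‖ ^ 2 / 2)) := by
      simp_rw [hν, fourierLaplace_withDensity]
      exact hF h
    refine (le_smul_volume_of_lintegral_fourierLaplace_ne_top ν
      (hFh.trans_lt ENNReal.ofReal_lt_top).ne).trans ?_
    exact Measure.le_iff.2 fun s _ => by
      simp only [Measure.smul_apply, smul_eq_mul]; gcongr
  have hac : P.map Z ≪ volume := by
    have h0 := htilt 0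
    simp only [inner_zero_left, Real.exp_zero, ENNReal.ofReal_one, withDensity_const, one_smul]
      at h0
    exact (Measure.absolutelyContinuous_of_le h0).trans (Measure.smul_absolutelyContinuous)
  have hpdf : HasPDF Z P volume := ⟨hZ, inferInstance, hac⟩
  refine ⟨hpdf, ?_⟩
  have hae : ∀ᵐ x, ∀ k : ℕ, pdf Z P volume x *
      ENNReal.ofReal (rexp ⟪TopologicalSpace.denseSeq (EuclideanSpace ℝ (Fin d)) k, x⟫) ≤
        ENNReal.ofReal
          (B * rexp (‖TopologicalSpace.denseSeq (EuclideanSpace ℝ (Fin d)) k‖ ^ 2 / 2)) := by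
    refine ae_all_iff.2 fun k => ?_
    have hk := htilt (TopologicalSpace.denseSeq (EuclideanSpace ℝ (Fin d)) k)
    rw [map_eq_withDensity_pdf Z P volume,
      ← withDensity_mul _ (measurable_pdf _ _ _) (by fun_prop), ← withDensity_const] at hk
    refine ae_le_of_forall_setLIntegral_le_of_sigmaFinite
      ((measurable_pdf Z P volume).mul (by fun_prop)) fun s hs _ => ?_
    have := Measure.le_iff.1 hk s hs
    rwa [withDensity_apply _ hs, withDensity_apply _ hs] at this
  filter_upwards [hae, ofReal_toReal_pdf_ae_eq (P := P) (Z := Z)] with x hx hp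
  rw [← hp] at hx ⊢
  set p := (pdf Z P volume x).toReal
  have hp0 : 0 ≤ p := ENNReal.toReal_nonneg
  have hclosed : IsClosed {h : EuclideanSpace ℝ (Fin d) |
      p * rexp ⟪h, x⟫ ≤ B * rexp (‖h‖ ^ 2 / 2)} :=
    isClosed_le (by fun_prop) (by fun_prop)
  have hall : ∀ h : EuclideanSpace ℝ (Fin d), p * rexp ⟪h, x⟫ ≤ B * rexp (‖h‖ ^ 2 / 2) := by
    intro h
    refine (TopologicalSpace.denseRange_denseSeq _).induction_on h hclosed fun k => ?_
    have := hx k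
    rwa [← ENNReal.ofReal_mul hp0, ENNReal.ofReal_le_ofReal_iff (by positivity)] at this
  refine ENNReal.ofReal_le_ofReal ?_
  have h1 := hall x
  rw [real_inner_self_eq_norm_sq] at h1
  calc p = p * rexp (‖x‖ ^ 2) * rexp (-‖x‖ ^ 2) := by
        rw [mul_assoc, ← Real.exp_add]; simp
    _ ≤ B * rexp (‖x‖ ^ 2 / 2) * rexp (-‖x‖ ^ 2) := by gcongr
    _ = c * stdNormalDensity d x := by
        rw [hB, stdNormalDensity, mul_assoc, ← Real.exp_add,
          Real.div_rpow zero_le_one (by positivity), Real.one_rpow, mul_assoc]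
        congr 3
        ring

end DensityBound

/-! ### Convergence of `T_∞` -/

theorem corollary1p3 {d : ℕ}
    {Ω₀ : Type*} [MeasurableSpace Ω₀] (P₀ : Measure Ω₀) [IsProbabilityMeasure P₀]
    (X : Ω₀ → EuclideanSpace ℝ (Fin d)) (hX : AEMeasurable X P₀)
    (hmean : ∫ ω, X ω ∂P₀ = 0)
    (hcov : ∀ i j : Fin d,
      covariance (fun ω => X ω i) (fun ω => X ω j) P₀ = if i = j then 1 else 0)
    (hsep : HasSeparationProperty X P₀)
    {Ω : Type*} [MeasurableSpace Ω] (P : Measure Ω) [IsProbabilityMeasure P]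
    (Xs : ℕ → Ω → EuclideanSpace ℝ (Fin d))
    (hindep : iIndepFun Xs P)
    (hident : ∀ k, IdentDistrib (Xs k) X P P₀)
    (hfin : ∃ n₀ : ℕ, 1 ≤ n₀ ∧ HasPDF (normalizedSum Xs n₀) P volume ∧
      tsallisInf (densityOf (normalizedSum Xs n₀) P) (stdNormalDensity d) < ⊤) :
    (∀ᶠ n : ℕ in atTop, HasPDF (normalizedSum Xs n) P volume) ∧
    Tendsto
      (fun n : ℕ => tsallisInf (densityOf (normalizedSum Xs n) P) (stdNormalDensity d))
      atTop (𝓝 0) := by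
  obtain ⟨m, hm, hpdf, hT⟩ := hfin
  have hXs (k : ℕ) : AEMeasurable (Xs k) P := (hident k).aemeasurable_fst
  have hlaw (k : ℕ) : P.map (Xs k) = P₀.map X := (hident k).map_eq
  have := Measure.isProbabilityMeasure_map hX
  have hexp := hsep.integrable_exp hX
  have hle := hsep.integral_exp_le hX
  have h4 := memLp_of_integrable_exp hexp
  have h2 : MemLp id 2 (P₀.map X) := h4.mono_exponent (by norm_num)
  obtain ⟨K, hK, hp⟩ := exists_pdf_le_of_tsallisInf_lt_top hT
  have hmain (ε : ℝ) (hε : 0 < ε) : ∀ᶠ n : ℕ in atTop,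
      HasPDF (normalizedSum Xs n) P volume ∧
        tsallisInf (densityOf (normalizedSum Xs n) P) (stdNormalDensity d) ≤ ε := by
    have hev := eventually_lintegral_fourierLaplace_le hexp hle h4
      (integral_inner_map_eq_zero hX hmean h2) (integral_sq_inner_map hX hmean hcov h2)
      (tendsto_norm_fourierLaplace_zero hXs hindep hlaw hm)
      (fun t ht => hsep.exists_le hX ht) (by positivity)
      (lintegral_fourierLaplace_pow_le hXs hindep hlaw hexp hle hm hK hp) hε
    filter_upwards [hev, eventually_gt_atTop 0] with n hn hn0
    obtain ⟨h1, h2⟩ := hasPDF_and_pdf_le_of_lintegral_fourierLaplace_le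
      (aemeasurable_normalizedSum hXs n)
      (fun h => (integrable_exp_normalizedSum hXs hindep hlaw hexp hle hn0 h).1)
      (c := 1 + ε) (by positivity) fun h => by
        simpa only [fourierLaplace_normalizedSum hXs hindep hlaw, enorm_pow,
          finrank_euclideanSpace_fin] using hn h
    exact ⟨h1, tsallisInf_densityOf_le hε.le h2⟩
  have hev : ∀ᶠ n : ℕ in atTop, HasPDF (normalizedSum Xs n) P volume :=
    (hmain 1 one_pos).mono fun n hn => hn.1
  refine ⟨hev, tendsto_order.2 ⟨fun a ha => ?_, fun a ha => ?_⟩⟩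
  · filter_upwards [hev] with n hn
    exact ha.trans_le tsallisInf_densityOf_nonneg
  · obtain ⟨ε, hε0, hεa⟩ := EReal.lt_iff_exists_real_btwn.1 ha
    filter_upwards [hmain ε (by exact_mod_cast hε0)] with n hn
    exact hn.2.trans_lt hεa
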